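/- **Setting.** Let $L$ be a first-order language (constants, function symbols, predicate symbols, variables, $\bot$, $\land,\lor,\to,\forall,\exists$; no equality), and let $V\subseteq[0,1]$ be a closed set with $0,1\in V$. An interpretation $\mathfrak I$ based on $V$ consists of a nonempty domain $D$, functions $D^n\to D$ for the $n$-ary function symbols, functions $D^n\to V$ for the $n$-ary predicate symbols, and elements of $D$ for the variables. Formulas are evaluated by $\mathfrak I(\bot)=0$, $\mathfrak I(A\land B)=\min(\mathfrak I(A),\mathfrak I(B))$, $\mathfrak I(A\lor B)=\max(\mathfrak I(A),\mathfrak I(B))$, $\mathfrak I(A\to B)=\mathfrak I(B)$ if $\mathfrak I(A)>\mathfrak I(B)$ and $=1$ otherwise, $\mathfrak I(\forall x\,A(x))=\inf_{d\in D}\mathfrak I(A(d))$, $\mathfrak I(\exists x\,A(x))=\sup_{d\in D}\mathfrak I(A(d))$. A formula $A$ is valid in the Gödel logic $\mathbf G_V$ if $\mathfrak I(A)=1$ for every interpretation $\mathfrak I$ based on $V$. The prenex fragment of $\mathbf G_V$ is the set of prenex formulas (a string of quantifiers followed by a quantifier-free formula) that are valid in $\mathbf G_V$. Let $\mathbf{LC}^{*}$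 be the Hilbert calculus whose axioms are all first-order instances of the axiom schemata of intuitionistic propositional logic and of the linearity schema $(A\to B)\lor(B\to A)$, and whose rules are modus ponens and * from $A(y)$ infer $\forall x\,A(x)$, where $y$ is a variable not free in $\forall x\,A(x)$; * from $A(t)$ infer $\exists x\,A(x)$, where $t$ is a term; * from $\forall x\,(A(x)\lor B)$ infer $\forall x\,A(x)\lor B$, where $x$ is not free in $B$; * from $\exists x\,(A(x)\lor B)$ infer $\exists x\,A(x)\lor B$, where $x$ is not free in $B$. For $m\ge 2$ let $G_m$ be the schema $\bigvee_{i=1}^{m}\bigvee_{j=i+1}^{m+1}\bigl((A_i\to A_j)\land(A_j\to A_i)\bigr)$. **Theorem.** Let $V$ be finite or uncountable. Then the prenex fragment of $\mathbf G_V$ is axiomatizable. More precisely: 1. If $V$ has exactly $m$ elements, then a prenex formula is valid in $\mathbf G_V$ if and only if it is derivable in $\mathbf{LC}^{*}+G_m$. 2. If $V$ is uncountable, then a prenex formula is valid in $\mathbf G_V$ if and only if it is derivable in $\mathbf{LC}^{*}$. 3. In both cases, if $L$ is effectively given (its function symbols and its predicate symbols are coded by natural numbers such that the sets of codes are primitive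 recursive and the arities are computable), then the set of Gödel numbers of the prenex formulas that are valid in $\mathbf G_V$ is recursively enumerable. -/

import Mathlib

universe u v w

namespace GoedelLogic

/-- A truth value set: a closed subset of `[0, 1]` containing `0` and `1`. -/
structure IsTruthValueSet (V : Set ℝ) : Prop where
  subset_Icc : V ⊆ Set.Icc 0 1
  isClosed : IsClosed V
  zero_mem : (0 : ℝ) ∈ V
  one_mem : (1 : ℝ) ∈ V

/-- First-order formulas over the function and relation symbols of `L` (constants are the function
symbols of arity `0`; there is no equality symbol). The individual variables are indexed by `ℕ`, and
formulas are taken up to renaming of bound variables, in the style of de Bruijn: in `all φ` and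
`ex φ` the index `0` of `φ` is the bound variable and the index `k + 1` of `φ` is the variable
with index `k` outside. -/
inductive Formula (L : FirstOrder.Language.{u, v}) : Type (max u v)
  | bot : Formula L
  | rel {n : ℕ} (R : L.Relations n) (ts : Fin n → L.Term ℕ) : Formula L
  | and (φ ψ : Formula L) : Formula L
  | or (φ ψ : Formula L) : Formula L
  | imp (φ ψ : Formula L) : Formula L
  | all (φ : Formula L) : Formula L
  | ex (φ : Formula L) : Formula L

section Formulas

variable {L : FirstOrder.Language.{u, v}}

/-- The substitution `σ` moved under a quantifier. -/
def upSubst (σ : ℕ → L.Term ℕ) : ℕ → L.Term ℕ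
  | 0 => FirstOrder.Language.Term.var 0
  | k + 1 => (σ k).relabel Nat.succ

/-- The substitution that replaces variable `0` by `t` and renames `k + 1` to `k`. -/
def instSubst (t : L.Term ℕ) : ℕ → L.Term ℕ
  | 0 => t
  | k + 1 => FirstOrder.Language.Term.var k

/-- Simultaneous capture-avoiding substitution of `σ k` for the variable `k`. -/
def Formula.subst : Formula L → (ℕ → L.Term ℕ) → Formula L
  | .bot, _ => .bot
  | .rel R ts, σ => .rel R (fun i => (ts i).subst σ)
  | .and φ ψ, σ => .and (φ.subst σ) (ψ.subst σ)
  | .or φ ψ, σ => .or (φ.subst σ) (ψ.subst σ)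
  | .imp φ ψ, σ => .imp (φ.subst σ) (ψ.subst σ)
  | .all φ, σ => .all (φ.subst (upSubst σ))
  | .ex φ, σ => .ex (φ.subst (upSubst σ))

/-- If `∀ x A(x)` is `all φ` (or `∃ x A(x)` is `ex φ`), then `φ.inst t` is `A(t)`. -/
def Formula.inst (φ : Formula L) (t : L.Term ℕ) : Formula L := φ.subst (instSubst t)

/-- `B.lift` is `B` as a formula under one further quantifier whose variable does not occur
free in `B`. -/
def Formula.lift (φ : Formula L) : Formula L := φ.subst (fun k => FirstOrder.Language.Term.var (k + 1))

/-- The variable `y` occurs free in the formula. -/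
def Formula.FreeIn : ℕ → Formula L → Prop
  | _, .bot => False
  | y, .rel _ ts => ∃ i, y ∈ (ts i).varFinset
  | y, .and φ ψ => φ.FreeIn y ∨ ψ.FreeIn y
  | y, .or φ ψ => φ.FreeIn y ∨ ψ.FreeIn y
  | y, .imp φ ψ => φ.FreeIn y ∨ ψ.FreeIn y
  | y, .all φ => φ.FreeIn (y + 1)
  | y, .ex φ => φ.FreeIn (y + 1)

def Formula.QuantifierFree : Formula L → Prop
  | .bot => True
  | .rel _ _ => True
  | .and φ ψ => φ.QuantifierFree ∧ ψ.QuantifierFree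
  | .or φ ψ => φ.QuantifierFree ∧ ψ.QuantifierFree
  | .imp φ ψ => φ.QuantifierFree ∧ ψ.QuantifierFree
  | .all _ => False
  | .ex _ => False

/-- A prenex formula: a string of quantifiers followed by a quantifier-free formula. -/
inductive Formula.IsPrenex : Formula L → Prop
  | of_quantifierFree {φ : Formula L} : φ.QuantifierFree → Formula.IsPrenex φ
  | all {φ : Formula L} : Formula.IsPrenex φ → Formula.IsPrenex (.all φ)
  | ex {φ : Formula L} : Formula.IsPrenex φ → Formula.IsPrenex (.ex φ)

end Formulas

section Semantics

variable {L : FirstOrder.Language.{u, v}}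

/-- A many-valued interpretation based on `V` with domain `D`; the values of the variables are
given separately, by an assignment `s : ℕ → D`. -/
structure Interpretation (L : FirstOrder.Language.{u, v}) (V : Set ℝ) (D : Type w) where
  func : ∀ {n : ℕ}, L.Functions n → (Fin n → D) → D
  rel : ∀ {n : ℕ}, L.Relations n → (Fin n → D) → V

/-- The assignment giving `d` to the variable `0` and `s k` to the variable `k + 1`. -/
def consVal {D : Type w} (d : D) (s : ℕ → D) : ℕ → D
  | 0 => d
  | k + 1 => s k

variable {V : Set ℝ} {D : Type w}

def Interpretation.termValue (I : Interpretation L V D) (s : ℕ → D) : L.Term ℕ → D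
  | .var k => s k
  | .func f ts => I.func f (fun i => I.termValue s (ts i))

/-- The truth value of a formula. When `V` is a truth value set, every value lies in `V`, so
the infima and suprema below are those of nonempty bounded sets. -/
noncomputable def Interpretation.value (I : Interpretation L V D) : Formula L → (ℕ → D) → ℝ
  | .bot, _ => 0
  | .rel R ts, s => (I.rel R (fun i => I.termValue s (ts i)) : ℝ)
  | .and φ ψ, s => min (I.value φ s) (I.value ψ s)
  | .or φ ψ, s => max (I.value φ s) (I.value ψ s)
  | .imp φ ψ, s => if I.value φ s > I.value ψ s then I.value ψ s else 1
  | .all φ, s => ⨅ d : D, I.value φ (consVal d s)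
  | .ex φ, s => ⨆ d : D, I.value φ (consVal d s)

/-- Validity in the Gödel logic based on `V`: the value is `1` in every interpretation based on
`V` (with a domain in `Type w`) under every assignment. -/
def Valid (V : Set ℝ) (φ : Formula L) : Prop :=
  ∀ (D : Type w) (I : Interpretation L V D) (s : ℕ → D), I.value φ s = 1

end Semantics

section Calculus

variable {L : FirstOrder.Language.{u, v}}

/-- The disjunction of the formulas in a list, associated to the right. -/
def bigOr : List (Formula L) → Formula L
  | [] => .bot
  | [φ] => φ
  | φ :: ψ :: l => .or φ (bigOr (ψ :: l))

/-- The formula `⋁_{i < m} ⋁_{i < j ≤ m} ((A i → A j) ∧ (A j → A i))` in the `m + 1` formulas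
`A 0, …, A m`. -/
def charFormula (m : ℕ) (A : ℕ → Formula L) : Formula L :=
  bigOr ((List.range m).map fun i =>
    bigOr ((List.range' (i + 1) (m - i)).map fun j =>
      .and (.imp (A i) (A j)) (.imp (A j) (A i))))

/-- All instances of the characteristic axiom of `m`-valued Gödel logic. -/
def charAxioms (L : FirstOrder.Language.{u, v}) (m : ℕ) : Set (Formula L) :=
  {φ | ∃ A : ℕ → Formula L, φ = charFormula m A}

/-- Derivability from the additional axioms `T` in the Hilbert calculus that consists of
intuitionistic propositional logic, the linearity axiom, modus ponens and four
quantifier rules. The axioms are schemata over all first-order formulas. -/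
inductive Derivable (T : Set (Formula L)) : Formula L → Prop
  | ax {A : Formula L} : A ∈ T → Derivable T A
  | imp_k (A B : Formula L) : Derivable T (.imp A (.imp B A))
  | imp_s (A B C : Formula L) :
      Derivable T (.imp (.imp A (.imp B C)) (.imp (.imp A B) (.imp A C)))
  | and_left (A B : Formula L) : Derivable T (.imp (.and A B) A)
  | and_right (A B : Formula L) : Derivable T (.imp (.and A B) B)
  | and_intro (A B : Formula L) : Derivable T (.imp A (.imp B (.and A B)))
  | or_left (A B : Formula L) : Derivable T (.imp A (.or A B))
  | or_right (A B : Formula L) : Derivable T (.imp B (.or A B))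
  | or_elim (A B C : Formula L) :
      Derivable T (.imp (.imp A C) (.imp (.imp B C) (.imp (.or A B) C)))
  | bot_elim (A : Formula L) : Derivable T (.imp .bot A)
  | linear (A B : Formula L) : Derivable T (.or (.imp A B) (.imp B A))
  | mp {A B : Formula L} : Derivable T (.imp A B) → Derivable T A → Derivable T B
  /-- From `A(y)` infer `∀ x A(x)`, where `y` is not free in `∀ x A(x)`. -/
  | all_intro {A : Formula L} (y : ℕ) : ¬ (Formula.all A).FreeIn y →
      Derivable T (A.inst (FirstOrder.Language.Term.var y)) → Derivable T (.all A)
  /-- From `A(t)` infer `∃ x A(x)`. -/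
  | ex_intro {A : Formula L} (t : L.Term ℕ) :
      Derivable T (A.inst t) → Derivable T (.ex A)
  /-- From `∀ x (A(x) ∨ B)` infer `∀ x A(x) ∨ B`, where `x` is not free in `B`. -/
  | all_or {A B : Formula L} :
      Derivable T (.all (.or A B.lift)) → Derivable T (.or (.all A) B)
  /-- From `∃ x (A(x) ∨ B)` infer `∃ x A(x) ∨ B`, where `x` is not free in `B`. -/
  | ex_or {A B : Formula L} :
      Derivable T (.ex (.or A B.lift)) → Derivable T (.or (.ex A) B)

end Calculus

section Coding

variable {L : FirstOrder.Language.{u, v}}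
  [Encodable (Σ n, L.Functions n)] [Encodable (Σ n, L.Relations n)]

/-- The Gödel number of a term, relative to a coding of the function symbols. -/
def termCode : L.Term ℕ → ℕ
  | .var k => 2 * k
  | @FirstOrder.Language.Term.func _ _ n f ts =>
      2 * Nat.pair (Encodable.encode (⟨n, f⟩ : Σ n, L.Functions n))
        (Encodable.encode (List.ofFn fun i => termCode (ts i))) + 1

/-- The Gödel number of a formula, relative to a coding of the symbols. -/
def Formula.code : Formula L → ℕ
  | .bot => 0
  | @Formula.rel _ n R ts =>
      7 * Nat.pair (Encodable.encode (⟨n, R⟩ : Σ n, L.Relations n))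
        (Encodable.encode (List.ofFn fun i => termCode (ts i))) + 1
  | .and φ ψ => 7 * Nat.pair φ.code ψ.code + 2
  | .or φ ψ => 7 * Nat.pair φ.code ψ.code + 3
  | .imp φ ψ => 7 * Nat.pair φ.code ψ.code + 4
  | .all φ => 7 * φ.code + 5
  | .ex φ => 7 * φ.code + 6

end Coding

end GoedelLogic

/-!
# The prenex fragment of Gödel logics is axiomatizable

Soundness (`GenDerivable.valid`) is checked rule by rule, after the eigenvariable rule has been
replaced by generalization from `A` to `∀ x A` (`Derivable.genDerivable_subst`).

Completeness avoids Herbrand functions. If a prenex formula `φ` is not derivable, the quantifier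
rules read backwards turn `φ` into a set `Γ` of prenex formulas such that every universal member
has an instance with a variable in `Γ`, every existential member has all its instances in `Γ`, and
no finite disjunction of members of `Γ` is derivable (`exists_saturated`). This is where the two
rules that shift a quantifier out of a disjunction are used. Zorn's lemma gives a prime theory `Θ`
disjoint from `Γ` (`exists_prime_theory`); by the linearity axioms, implication in `Θ` orders the
formulas linearly, and the quotient is a countable chain with end points. If `V` has `m` elements,
the characteristic axioms bound the size of the chain by `m`. If `V` is uncountable, its two-sided
condensation points form a densely ordered set, into which every countable chain embeds. In both
cases the chain embeds into `V` so that the members of `Γ`, which lie below the top of the chain,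
get values below a common bound `α < 1` (`exists_valuation`). The bound is what makes the suprema
in the term model harmless: by induction every prenex formula in `Γ`, in particular `φ`, has a
value of at most `α` there (`derivable_of_valid_of_countable`). Arbitrary languages are reduced to
countable ones by discarding the symbols that do not occur in `φ` (`derivable_of_valid`).

For recursive enumerability, the calculus and the substitutions it refers to are written as a
program of Horn clauses on Gödel numbers. The set of numbers that a Horn program derives is
recursively enumerable (`rePred_ruleClosure`), and the program derives exactly the numbers of the
derivable prenex formulas (`ruleClosure_iff`), which are the valid ones.
-/

namespace GoedelLogic

open FirstOrder.Language (Term)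

variable {L : FirstOrder.Language.{u, v}}

/-! ### Substitution -/

theorem term_subst_subst (t : L.Term ℕ) (σ τ : ℕ → L.Term ℕ) :
    (t.subst σ).subst τ = t.subst (fun k => (σ k).subst τ) := by
  induction t with
  | var k => rfl
  | func f ts ih => simp [Term.subst, ih]

theorem term_relabel_eq_subst (t : L.Term ℕ) (f : ℕ → ℕ) :
    t.relabel f = t.subst (fun k => Term.var (f k)) := by
  induction t with
  | var k => rfl
  | func f ts ih => simp [Term.subst, Term.relabel, ih]

theorem term_subst_var (t : L.Term ℕ) : t.subst Term.var = t := by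
  induction t with
  | var k => rfl
  | func f ts ih => simp [Term.subst, ih]

theorem term_subst_congr (t : L.Term ℕ) {σ τ : ℕ → L.Term ℕ}
    (h : ∀ k ∈ t.varFinset, σ k = τ k) : t.subst σ = t.subst τ := by
  induction t with
  | var k => exact h k (by simp [Term.varFinset])
  | func f ts ih =>
    simp only [Term.subst, Term.func.injEq, heq_eq_eq, true_and]
    funext i
    exact ih i fun k hk => h k (by simpa [Term.varFinset] using ⟨i, hk⟩)

theorem upSubst_var : upSubst (Term.var : ℕ → L.Term ℕ) = Term.var := by
  funext k
  cases k <;> rfl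

theorem upSubst_comp (σ τ : ℕ → L.Term ℕ) (k : ℕ) :
    (upSubst σ k).subst (upSubst τ) = upSubst (fun k => (σ k).subst τ) k := by
  cases k with
  | zero => rfl
  | succ k =>
    simp only [upSubst, term_relabel_eq_subst, term_subst_subst, Term.subst]

theorem Formula.subst_subst (φ : Formula L) (σ τ : ℕ → L.Term ℕ) :
    (φ.subst σ).subst τ = φ.subst (fun k => (σ k).subst τ) := by
  induction φ generalizing σ τ with
  | bot => rfl
  | rel R ts => simp [Formula.subst, term_subst_subst]
  | and φ ψ ih₁ ih₂ | or φ ψ ih₁ ih₂ | imp φ ψ ih₁ ih₂ => simp [Formula.subst, ih₁, ih₂]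
  | all φ ih | ex φ ih => simp [Formula.subst, ih, upSubst_comp]

theorem Formula.subst_var (φ : Formula L) : φ.subst Term.var = φ := by
  induction φ with
  | bot => rfl
  | rel R ts => simp [Formula.subst, term_subst_var]
  | and φ ψ ih₁ ih₂ | or φ ψ ih₁ ih₂ | imp φ ψ ih₁ ih₂ => simp [Formula.subst, ih₁, ih₂]
  | all φ ih | ex φ ih => simp [Formula.subst, ih, upSubst_var]

theorem Formula.subst_congr (φ : Formula L) {σ τ : ℕ → L.Term ℕ}
    (h : ∀ k, φ.FreeIn k → σ k = τ k) : φ.subst σ = φ.subst τ := by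
  induction φ generalizing σ τ with
  | bot => rfl
  | rel R ts =>
    simp only [Formula.subst, Formula.rel.injEq, heq_eq_eq, true_and]
    funext i
    exact term_subst_congr _ fun k hk => h k ⟨i, hk⟩
  | and φ ψ ih₁ ih₂ | or φ ψ ih₁ ih₂ | imp φ ψ ih₁ ih₂ =>
    simp only [Formula.subst, ih₁ fun k hk => h k (Or.inl hk), ih₂ fun k hk => h k (Or.inr hk)]
  | all φ ih | ex φ ih =>
    simp only [Formula.subst]
    rw [ih]
    intro k hk
    cases k with
    | zero => rfl
    | succ k => simp [upSubst, h k hk]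

theorem Formula.inst_lift (φ : Formula L) (t : L.Term ℕ) : φ.lift.inst t = φ := by
  rw [Formula.inst, Formula.lift, Formula.subst_subst]
  exact φ.subst_var

theorem Formula.inst_subst (φ : Formula L) (t : L.Term ℕ) (σ : ℕ → L.Term ℕ) :
    (φ.inst t).subst σ = (φ.subst (upSubst σ)).inst (t.subst σ) := by
  simp only [Formula.inst, Formula.subst_subst]
  congr 1
  funext k
  cases k with
  | zero => rfl
  | succ k =>
    simp only [instSubst, upSubst, term_relabel_eq_subst, term_subst_subst]
    exact (term_subst_var _).symm

theorem Formula.lift_subst (φ : Formula L) (σ : ℕ → L.Term ℕ) :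
    φ.lift.subst (upSubst σ) = (φ.subst σ).lift := by
  simp only [Formula.lift, Formula.subst_subst]
  congr 1
  funext k
  simp only [Term.subst, upSubst, term_relabel_eq_subst]

theorem term_exists_fresh (t : L.Term ℕ) : ∃ n, ∀ y ≥ n, y ∉ t.varFinset :=
  ⟨t.varFinset.sup id + 1, fun y hy h => by
    have := Finset.le_sup (f := id) h
    simp only [id] at this
    omega⟩

/-- Only finitely many variables occur free in a formula. -/
theorem Formula.exists_fresh (φ : Formula L) : ∃ n, ∀ y ≥ n, ¬ φ.FreeIn y := by
  induction φ with
  | bot => exact ⟨0, fun _ _ h => h⟩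
  | rel R ts =>
    choose n hn using fun i => term_exists_fresh (ts i)
    refine ⟨Finset.univ.sup n, fun y hy h => ?_⟩
    obtain ⟨i, hi⟩ := h
    exact hn i y ((Finset.le_sup (Finset.mem_univ i)).trans hy) hi
  | and φ ψ ih₁ ih₂ | or φ ψ ih₁ ih₂ | imp φ ψ ih₁ ih₂ =>
    obtain ⟨n₁, h₁⟩ := ih₁
    obtain ⟨n₂, h₂⟩ := ih₂
    exact ⟨max n₁ n₂, fun y hy h => h.elim (h₁ y (le_of_max_le_left hy))
      (h₂ y (le_of_max_le_right hy))⟩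
  | all φ ih | ex φ ih =>
    obtain ⟨n, hn⟩ := ih
    exact ⟨n, fun y hy h => hn (y + 1) (by omega) h⟩

/-! ### The characteristic axioms under maps that commute with the connectives -/

theorem map_bigOr {L' : FirstOrder.Language.{u, v}} (f : Formula L → Formula L')
    (hbot : f .bot = .bot) (hor : ∀ A B, f (.or A B) = .or (f A) (f B)) (l : List (Formula L)) :
    f (bigOr l) = bigOr (l.map f) := by
  induction l with
  | nil => exact hbot
  | cons A l ih =>
    cases l with
    | nil => rfl
    | cons B l => simpa [bigOr, hor] using ih

theorem map_charFormula {L' : FirstOrder.Language.{u, v}} (f : Formula L → Formula L')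
    (hbot : f .bot = .bot) (hor : ∀ A B, f (.or A B) = .or (f A) (f B))
    (hand : ∀ A B, f (.and A B) = .and (f A) (f B))
    (himp : ∀ A B, f (.imp A B) = .imp (f A) (f B)) (m : ℕ) (A : ℕ → Formula L) :
    f (charFormula m A) = charFormula m (fun i => f (A i)) := by
  simp only [charFormula, map_bigOr f hbot hor, List.map_map]
  congr 1
  refine List.map_congr_left fun i _ => ?_
  simp only [Function.comp_apply, map_bigOr f hbot hor, List.map_map]
  congr 1
  refine List.map_congr_left fun j _ => ?_
  simp only [Function.comp_apply, hand, himp]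

/-- The set of formulas is closed under substitution, like the set of all instances of a schema. -/
def SubstClosed (T : Set (Formula L)) : Prop :=
  ∀ A ∈ T, ∀ σ : ℕ → L.Term ℕ, A.subst σ ∈ T

theorem substClosed_charAxioms (m : ℕ) : SubstClosed (charAxioms L m) := by
  rintro _ ⟨A, rfl⟩ σ
  exact ⟨fun i => (A i).subst σ, map_charFormula (fun φ : Formula L => φ.subst σ) rfl
    (fun _ _ => rfl) (fun _ _ => rfl) (fun _ _ => rfl) m A⟩

/-! ### The calculus without eigenvariables -/

/-- The calculus `Derivable` with generalization from `A` to `∀ x A` in place of the rule with an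
eigenvariable: the free variable `0` of `A` becomes the bound one. -/
inductive GenDerivable (T : Set (Formula L)) : Formula L → Prop
  | ax {A : Formula L} : A ∈ T → GenDerivable T A
  | imp_k (A B : Formula L) : GenDerivable T (.imp A (.imp B A))
  | imp_s (A B C : Formula L) :
      GenDerivable T (.imp (.imp A (.imp B C)) (.imp (.imp A B) (.imp A C)))
  | and_left (A B : Formula L) : GenDerivable T (.imp (.and A B) A)
  | and_right (A B : Formula L) : GenDerivable T (.imp (.and A B) B)
  | and_intro (A B : Formula L) : GenDerivable T (.imp A (.imp B (.and A B)))
  | or_left (A B : Formula L) : GenDerivable T (.imp A (.or A B))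
  | or_right (A B : Formula L) : GenDerivable T (.imp B (.or A B))
  | or_elim (A B C : Formula L) :
      GenDerivable T (.imp (.imp A C) (.imp (.imp B C) (.imp (.or A B) C)))
  | bot_elim (A : Formula L) : GenDerivable T (.imp .bot A)
  | linear (A B : Formula L) : GenDerivable T (.or (.imp A B) (.imp B A))
  | mp {A B : Formula L} : GenDerivable T (.imp A B) → GenDerivable T A → GenDerivable T B
  | all_intro {A : Formula L} : GenDerivable T A → GenDerivable T (.all A)
  | ex_intro {A : Formula L} (t : L.Term ℕ) : GenDerivable T (A.inst t) → GenDerivable T (.ex A)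
  | all_or {A B : Formula L} :
      GenDerivable T (.all (.or A B.lift)) → GenDerivable T (.or (.all A) B)
  | ex_or {A B : Formula L} :
      GenDerivable T (.ex (.or A B.lift)) → GenDerivable T (.or (.ex A) B)

theorem Derivable.genDerivable_subst {T : Set (Formula L)} (hT : SubstClosed T) {φ : Formula L}
    (h : Derivable T φ) (σ : ℕ → L.Term ℕ) : GenDerivable T (φ.subst σ) := by
  induction h generalizing σ with
  | ax h => exact .ax (hT _ h σ)
  | imp_k A B => exact .imp_k _ _
  | imp_s A B C => exact .imp_s _ _ _
  | and_left A B => exact .and_left _ _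
  | and_right A B => exact .and_right _ _
  | and_intro A B => exact .and_intro _ _
  | or_left A B => exact .or_left _ _
  | or_right A B => exact .or_right _ _
  | or_elim A B C => exact .or_elim _ _ _
  | bot_elim A => exact .bot_elim _
  | linear A B => exact .linear _ _
  | mp _ _ ih₁ ih₂ => exact .mp (ih₁ σ) (ih₂ σ)
  | @all_intro A y hy _ ih =>
    refine .all_intro ?_
    -- Send the eigenvariable to the variable `0`, which generalization then binds.
    have := ih fun k => if k = y then Term.var 0 else (σ k).relabel Nat.succ
    rw [Formula.inst, Formula.subst_subst] at this
    convert this using 1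
    refine A.subst_congr fun k hk => ?_
    cases k with
    | zero => simp [instSubst, upSubst, Term.subst]
    | succ k =>
      have hne : k ≠ y := fun e => hy (e ▸ hk)
      simp [instSubst, upSubst, Term.subst, hne]
  | ex_intro t _ ih =>
    refine .ex_intro (t.subst σ) ?_
    rw [← Formula.inst_subst]
    exact ih σ
  | @all_or A B _ ih =>
    refine .all_or ?_
    rw [← Formula.lift_subst]
    exact ih σ
  | @ex_or A B _ ih =>
    refine .ex_or ?_
    rw [← Formula.lift_subst]
    exact ih σ

theorem Derivable.genDerivable {T : Set (Formula L)} (hT : SubstClosed T) {φ : Formula L}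
    (h : Derivable T φ) : GenDerivable T φ := by
  simpa [Formula.subst_var] using h.genDerivable_subst hT Term.var

/-! ### Soundness -/

section Soundness

variable {V : Set ℝ} {D : Type w}

theorem Interpretation.value_mem (hV : IsTruthValueSet V) (I : Interpretation L V D)
    (φ : Formula L) (s : ℕ → D) : I.value φ s ∈ V := by
  have : Nonempty D := ⟨s 0⟩
  induction φ generalizing s with
  | bot => exact hV.zero_mem
  | rel R ts => exact Subtype.coe_prop _
  | and φ ψ ih₁ ih₂ =>
    rcases min_choice (I.value φ s) (I.value ψ s) with h | h <;> simp only [value, h, ih₁, ih₂]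
  | or φ ψ ih₁ ih₂ =>
    rcases max_choice (I.value φ s) (I.value ψ s) with h | h <;> simp only [value, h, ih₁, ih₂]
  | imp φ ψ ih₁ ih₂ =>
    simp only [value]
    split_ifs
    · exact ih₂ s
    · exact hV.one_mem
  | all φ ih =>
    have hsub : Set.range (fun d => I.value φ (consVal d s)) ⊆ V := by
      rintro _ ⟨d, rfl⟩
      exact ih _
    exact hV.isClosed.closure_subset_iff.2 hsub
      (csInf_mem_closure (Set.range_nonempty _)
        ⟨0, fun x hx => (hV.subset_Icc (hsub hx)).1⟩)
  | ex φ ih =>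
    have hsub : Set.range (fun d => I.value φ (consVal d s)) ⊆ V := by
      rintro _ ⟨d, rfl⟩
      exact ih _
    exact hV.isClosed.closure_subset_iff.2 hsub
      (csSup_mem_closure (Set.range_nonempty _)
        ⟨1, fun x hx => (hV.subset_Icc (hsub hx)).2⟩)

theorem Interpretation.value_le_one (hV : IsTruthValueSet V) (I : Interpretation L V D)
    (φ : Formula L) (s : ℕ → D) : I.value φ s ≤ 1 :=
  (hV.subset_Icc (I.value_mem hV φ s)).2

theorem Interpretation.value_nonneg (hV : IsTruthValueSet V) (I : Interpretation L V D)
    (φ : Formula L) (s : ℕ → D) : 0 ≤ I.value φ s :=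
  (hV.subset_Icc (I.value_mem hV φ s)).1

theorem Interpretation.termValue_subst (I : Interpretation L V D) (t : L.Term ℕ)
    (σ : ℕ → L.Term ℕ) (s : ℕ → D) :
    I.termValue s (t.subst σ) = I.termValue (fun k => I.termValue s (σ k)) t := by
  induction t with
  | var k => rfl
  | func f ts ih => simp [Term.subst, termValue, ih]

theorem Interpretation.value_subst (I : Interpretation L V D) (φ : Formula L)
    (σ : ℕ → L.Term ℕ) (s : ℕ → D) :
    I.value (φ.subst σ) s = I.value φ (fun k => I.termValue s (σ k)) := by
  have key : ∀ (σ : ℕ → L.Term ℕ) (s : ℕ → D) (d : D),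
      (fun k => I.termValue (consVal d s) (upSubst σ k)) =
        consVal d (fun k => I.termValue s (σ k)) := by
    intro σ s d
    funext k
    cases k with
    | zero => rfl
    | succ k =>
      simp only [upSubst, term_relabel_eq_subst, I.termValue_subst]
      rfl
  induction φ generalizing σ s with
  | bot => rfl
  | rel R ts => simp [Formula.subst, value, I.termValue_subst]
  | and φ ψ ih₁ ih₂ | or φ ψ ih₁ ih₂ | imp φ ψ ih₁ ih₂ => simp [Formula.subst, value, ih₁, ih₂]
  | all φ ih | ex φ ih => simp only [Formula.subst, value, ih, key]

theorem Interpretation.value_inst (I : Interpretation L V D) (φ : Formula L)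
    (t : L.Term ℕ) (s : ℕ → D) :
    I.value (φ.inst t) s = I.value φ (consVal (I.termValue s t) s) := by
  rw [Formula.inst, I.value_subst]
  congr 1
  funext k
  cases k <;> rfl

theorem Interpretation.value_lift (I : Interpretation L V D) (φ : Formula L) (d : D)
    (s : ℕ → D) : I.value φ.lift (consVal d s) = I.value φ s := by
  rw [Formula.lift, I.value_subst]
  rfl

theorem Interpretation.value_imp_eq_one (hV : IsTruthValueSet V) (I : Interpretation L V D)
    (A B : Formula L) (s : ℕ → D) :
    I.value (.imp A B) s = 1 ↔ I.value A s ≤ I.value B s := by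
  simp only [value]
  split_ifs with h
  · have := I.value_le_one hV A s
    constructor
    · intro e
      linarith
    · intro e
      linarith
  · simpa using h

theorem Interpretation.value_or_eq_one (hV : IsTruthValueSet V) (I : Interpretation L V D)
    (A B : Formula L) (s : ℕ → D) :
    I.value (.or A B) s = 1 ↔ I.value A s = 1 ∨ I.value B s = 1 := by
  have h₁ := I.value_le_one hV A s
  have h₂ := I.value_le_one hV B s
  simp only [value]
  rcases le_total (I.value A s) (I.value B s) with h | h
  · rw [max_eq_right h]
    constructor
    · exact Or.inr
    · rintro (e | e) <;> linarith
  · rw [max_eq_left h]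
    constructor
    · exact Or.inl
    · rintro (e | e) <;> linarith

theorem Interpretation.value_all_eq_one (hV : IsTruthValueSet V) (I : Interpretation L V D)
    (A : Formula L) (s : ℕ → D) :
    I.value (.all A) s = 1 ↔ ∀ d, I.value A (consVal d s) = 1 := by
  have : Nonempty D := ⟨s 0⟩
  constructor
  · intro h d
    refine le_antisymm (I.value_le_one hV _ _) (h.ge.trans ?_)
    exact ciInf_le ⟨0, by rintro _ ⟨d, rfl⟩; exact I.value_nonneg hV _ _⟩ d
  · intro h
    simp [value, h]

theorem GenDerivable.valid (hV : IsTruthValueSet V) {T : Set (Formula L)}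
    (hT : ∀ A ∈ T, Valid.{u, v, w} V A) {φ : Formula L} (h : GenDerivable T φ) :
    Valid.{u, v, w} V φ := by
  induction h with
  | ax h => exact hT _ h
  | imp_k A B =>
    intro D I s
    have h₁ := I.value_le_one hV A s
    rw [I.value_imp_eq_one hV]
    simp only [Interpretation.value]
    split_ifs <;> linarith
  | imp_s A B C =>
    intro D I s
    have h₁ := I.value_le_one hV A s
    have h₂ := I.value_le_one hV B s
    have h₃ := I.value_le_one hV C s
    rw [I.value_imp_eq_one hV]
    simp only [Interpretation.value]
    split_ifs <;> linarith
  | and_left A B =>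
    intro D I s
    rw [I.value_imp_eq_one hV]
    exact min_le_left _ _
  | and_right A B =>
    intro D I s
    rw [I.value_imp_eq_one hV]
    exact min_le_right _ _
  | and_intro A B =>
    intro D I s
    rw [I.value_imp_eq_one hV]
    have h₁ := I.value_le_one hV A s
    simp only [Interpretation.value]
    rcases le_total (I.value A s) (I.value B s) with h | h <;> simp only [h, min_eq_left,
      min_eq_right] <;> split_ifs <;> linarith
  | or_left A B =>
    intro D I s
    rw [I.value_imp_eq_one hV]
    exact le_max_left _ _
  | or_right A B =>
    intro D I s
    rw [I.value_imp_eq_one hV]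
    exact le_max_right _ _
  | or_elim A B C =>
    intro D I s
    have h₁ := I.value_le_one hV A s
    have h₂ := I.value_le_one hV B s
    have h₃ := I.value_le_one hV C s
    rw [I.value_imp_eq_one hV]
    simp only [Interpretation.value]
    rcases le_total (I.value A s) (I.value B s) with h | h <;> simp only [h, max_eq_left,
      max_eq_right] <;> split_ifs <;> linarith
  | bot_elim A =>
    intro D I s
    rw [I.value_imp_eq_one hV]
    exact I.value_nonneg hV A s
  | linear A B =>
    intro D I s
    rw [I.value_or_eq_one hV, I.value_imp_eq_one hV, I.value_imp_eq_one hV]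
    exact le_total _ _
  | @mp A B _ _ ih₁ ih₂ =>
    intro D I s
    have h₁ := (I.value_imp_eq_one hV A B s).1 (ih₁ D I s)
    rw [ih₂ D I s] at h₁
    exact le_antisymm (I.value_le_one hV _ _) h₁
  | all_intro _ ih =>
    intro D I s
    exact (I.value_all_eq_one hV _ s).2 fun d => ih D I _
  | @ex_intro A t _ ih =>
    intro D I s
    refine le_antisymm (I.value_le_one hV _ _) ?_
    have h := ih D I s
    rw [I.value_inst] at h
    rw [← h]
    exact le_ciSup (f := fun d => I.value A (consVal d s))
      ⟨1, by rintro _ ⟨d, rfl⟩; exact I.value_le_one hV _ _⟩ (I.termValue s t)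
  | @all_or A B _ ih =>
    intro D I s
    have h := (I.value_all_eq_one hV _ s).1 (ih D I s)
    rw [I.value_or_eq_one hV, I.value_all_eq_one hV]
    by_cases hB : I.value B s = 1
    · exact Or.inr hB
    · refine Or.inl fun d => ((I.value_or_eq_one hV _ _ _).1 (h d)).resolve_right ?_
      rwa [I.value_lift]
  | @ex_or A B _ ih =>
    intro D I s
    have : Nonempty D := ⟨s 0⟩
    have h := ih D I s
    refine le_antisymm (I.value_le_one hV _ _) (h.ge.trans (ciSup_le fun d => ?_))
    simp only [Interpretation.value, I.value_lift]
    exact max_le_max_right _ (le_ciSup (f := fun d => I.value A (consVal d s))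
      ⟨1, by rintro _ ⟨d, rfl⟩; exact I.value_le_one hV _ _⟩ d)

theorem Interpretation.value_bigOr_eq_one (hV : IsTruthValueSet V) (I : Interpretation L V D)
    {l : List (Formula L)} {A : Formula L} (hA : A ∈ l) {s : ℕ → D} (h : I.value A s = 1) :
    I.value (bigOr l) s = 1 := by
  induction l with
  | nil => simp at hA
  | cons B l ih =>
    cases l with
    | nil =>
      rw [List.mem_singleton] at hA
      simpa [bigOr, ← hA] using h
    | cons C l =>
      simp only [bigOr]
      rw [I.value_or_eq_one hV]
      rcases List.mem_cons.1 hA with rfl | hA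
      · exact Or.inl h
      · exact Or.inr (ih hA)

/-- By the pigeonhole principle, two of `m + 1` formulas have the same truth value. -/
theorem valid_of_mem_charAxioms (hV : IsTruthValueSet V) {m : ℕ} (hfin : V.Finite)
    (hm : V.ncard = m) : ∀ A ∈ charAxioms L m, Valid.{u, v, w} V A := by
  rintro _ ⟨A, rfl⟩ D I s
  obtain ⟨i, hi, j, hj, hne, heq⟩ : ∃ i ∈ Finset.range (m + 1), ∃ j ∈ Finset.range (m + 1),
      i ≠ j ∧ I.value (A i) s = I.value (A j) s := by
    refine Finset.exists_ne_map_eq_of_card_lt_of_maps_to (t := hfin.toFinset) ?_ ?_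
    · rw [← Set.ncard_eq_toFinset_card _ hfin, hm, Finset.card_range]
      exact Nat.lt_succ_self m
    · intro i _
      simpa using I.value_mem hV _ _
  wlog hij : i < j generalizing i j
  · exact this j hj i hi hne.symm heq.symm (by omega)
  rw [Finset.mem_range] at hi hj
  refine I.value_bigOr_eq_one hV (List.mem_map.2 ⟨i, List.mem_range.2 (by omega), rfl⟩) ?_
  refine I.value_bigOr_eq_one hV (List.mem_map.2 ⟨j, List.mem_range'_1.2 (by omega), rfl⟩) ?_
  simp only [Interpretation.value, heq]
  simp

end Soundness

/-! ### Prime theories -/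

/-- A theory over the axioms `T`: a set of formulas that contains the derivable ones and is closed
under modus ponens (but not necessarily under the quantifier rules). -/
structure IsTheory (T Θ : Set (Formula L)) : Prop where
  derivable_mem : ∀ {A : Formula L}, Derivable T A → A ∈ Θ
  mp : ∀ {A B : Formula L}, .imp A B ∈ Θ → A ∈ Θ → B ∈ Θ

/-- The disjunction of a list of formulas, with a final disjunct `⊥`. -/
def disj (l : List (Formula L)) : Formula L := l.foldr .or .bot

theorem isTheory_derivable (T : Set (Formula L)) : IsTheory T {A | Derivable T A} :=
  ⟨fun h => h, fun h₁ h₂ => Derivable.mp h₁ h₂⟩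

namespace IsTheory

variable {T Θ : Set (Formula L)} (h : IsTheory T Θ)
include h

theorem weaken {B : Formula L} (A : Formula L) (hB : B ∈ Θ) : .imp A B ∈ Θ :=
  h.mp (h.derivable_mem (.imp_k B A)) hB

theorem mp₂ {A B C : Formula L} (h₁ : .imp A (.imp B C) ∈ Θ) (h₂ : .imp A B ∈ Θ) :
    .imp A C ∈ Θ :=
  h.mp (h.mp (h.derivable_mem (.imp_s A B C)) h₁) h₂

theorem imp_refl (A : Formula L) : .imp A A ∈ Θ :=
  h.mp₂ (h.derivable_mem (.imp_k A (.imp A A))) (h.derivable_mem (.imp_k A A))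

theorem imp_trans {A B C : Formula L} (h₁ : .imp A B ∈ Θ) (h₂ : .imp B C ∈ Θ) :
    .imp A C ∈ Θ :=
  h.mp₂ (h.weaken A h₂) h₁

theorem or_imp {A B C : Formula L} (h₁ : .imp A C ∈ Θ) (h₂ : .imp B C ∈ Θ) :
    .imp (.or A B) C ∈ Θ :=
  h.mp (h.mp (h.derivable_mem (.or_elim A B C)) h₁) h₂

theorem imp_and {A B C : Formula L} (h₁ : .imp C A ∈ Θ) (h₂ : .imp C B ∈ Θ) :
    .imp C (.and A B) ∈ Θ :=
  h.mp₂ (h.imp_trans h₁ (h.derivable_mem (.and_intro A B))) h₂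

/-- The deduction theorem: the formulas that follow from `A` form a theory. -/
theorem adjoin (A : Formula L) : IsTheory T {C | .imp A C ∈ Θ} :=
  ⟨fun hC => h.weaken A (h.derivable_mem hC), fun h₁ h₂ => h.mp₂ h₁ h₂⟩

theorem imp_disj {A : Formula L} {l : List (Formula L)} (hA : A ∈ l) : .imp A (disj l) ∈ Θ := by
  induction l with
  | nil => simp at hA
  | cons B l ih =>
    rcases List.mem_cons.1 hA with rfl | hA
    · exact h.derivable_mem (.or_left _ _)
    · exact h.imp_trans (ih hA) (h.derivable_mem (.or_right _ _))

theorem disj_imp {C : Formula L} {l : List (Formula L)} (hl : ∀ A ∈ l, .imp A C ∈ Θ) :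
    .imp (disj l) C ∈ Θ := by
  induction l with
  | nil => exact h.derivable_mem (.bot_elim C)
  | cons B l ih =>
    exact h.or_imp (hl B (by simp)) (ih fun A hA => hl A (by simp [hA]))

theorem disj_mono {l l' : List (Formula L)} (hl : l ⊆ l') (hd : disj l ∈ Θ) : disj l' ∈ Θ :=
  h.mp (h.disj_imp fun _ hA => h.imp_disj (hl hA)) hd

end IsTheory

theorem exists_prime_theory {T Γ : Set (Formula L)}
    (hΓ : ∀ l : List (Formula L), (∀ A ∈ l, A ∈ Γ) → ¬ Derivable T (disj l)) :
    ∃ Θ : Set (Formula L), IsTheory T Θ ∧ Disjoint Γ Θ ∧ .bot ∉ Θ ∧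
      ∀ A B, .or A B ∈ Θ → A ∈ Θ ∨ B ∈ Θ := by
  -- The theories that avoid every finite disjunction of members of `Γ`.
  let S : Set (Set (Formula L)) :=
    {Θ | IsTheory T Θ ∧ ∀ l : List (Formula L), (∀ A ∈ l, A ∈ Γ) → disj l ∉ Θ}
  obtain ⟨Θ, -, hmax⟩ := zorn_subset_nonempty S (by
    intro c hc hchain hne
    obtain ⟨Θ₀, hΘ₀⟩ := hne
    refine ⟨⋃₀ c, ⟨⟨fun hA => ⟨Θ₀, hΘ₀, (hc hΘ₀).1.derivable_mem hA⟩, ?_⟩, ?_⟩,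
      fun s hs => Set.subset_sUnion_of_mem hs⟩
    · rintro A B ⟨s, hs, hAB⟩ ⟨s', hs', hA⟩
      rcases hchain.total hs hs' with hle | hle
      · exact ⟨s', hs', (hc hs').1.mp (hle hAB) hA⟩
      · exact ⟨s, hs, (hc hs).1.mp hAB (hle hA)⟩
    · rintro l hl ⟨s, hs, hd⟩
      exact (hc hs).2 l hl hd) {A | Derivable T A} ⟨isTheory_derivable T, hΓ⟩
  obtain ⟨hΘ, havoid⟩ := hmax.prop
  have hext : ∀ A, A ∉ Θ → ∃ l : List (Formula L), (∀ B ∈ l, B ∈ Γ) ∧ .imp A (disj l) ∈ Θ := by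
    intro A hA
    by_contra! hno
    have hsub := hmax.le_of_ge (y := {C : Formula L | Formula.imp A C ∈ Θ}) ⟨hΘ.adjoin A, hno⟩
      fun C hC => hΘ.weaken A hC
    exact hA (hsub (hΘ.imp_refl A))
  refine ⟨Θ, hΘ, Set.disjoint_left.2 fun A hA hA' => ?_, havoid [] (by simp), ?_⟩
  · exact havoid [A] (by simpa using hA) (hΘ.mp (hΘ.imp_disj (by simp)) hA')
  · intro A B hAB
    by_contra! hno
    obtain ⟨l₁, hl₁, h₁⟩ := hext A hno.1
    obtain ⟨l₂, hl₂, h₂⟩ := hext B hno.2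
    refine havoid (l₁ ++ l₂) (fun C hC => (List.mem_append.1 hC).elim (hl₁ C) (hl₂ C)) ?_
    refine hΘ.mp (hΘ.or_imp (hΘ.imp_trans h₁ (hΘ.disj_imp fun C hC => ?_))
      (hΘ.imp_trans h₂ (hΘ.disj_imp fun C hC => ?_))) hAB
    · exact hΘ.imp_disj (List.mem_append_left _ hC)
    · exact hΘ.imp_disj (List.mem_append_right _ hC)

theorem exists_mem_of_bigOr_mem {Θ : Set (Formula L)} (hbot : .bot ∉ Θ)
    (hprime : ∀ A B, .or A B ∈ Θ → A ∈ Θ ∨ B ∈ Θ) {l : List (Formula L)} (hl : bigOr l ∈ Θ) :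
    ∃ A ∈ l, A ∈ Θ := by
  induction l with
  | nil => exact absurd hl hbot
  | cons B l ih =>
    cases l with
    | nil => exact ⟨B, by simp, hl⟩
    | cons C l =>
      rcases hprime _ _ hl with h | h
      · exact ⟨B, by simp, h⟩
      · obtain ⟨A, hA, hA'⟩ := ih h
        exact ⟨A, List.mem_cons_of_mem _ hA, hA'⟩

/-! ### Embedding chains into truth value sets -/

/-- A chain `C` with least element `b` and greatest element `t` embeds into `V` so that `b` and `t`
go to `0` and `1` and the other values stay away from `1`. -/
def EmbedsIn (V : Set ℝ) (C : Type*) [LinearOrder C] (b t : C) : Prop :=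
  ∃ g : C → ℝ, StrictMono g ∧ (∀ x, g x ∈ V) ∧ g b = 0 ∧ g t = 1 ∧ ∃ α < 1, ∀ x < t, g x ≤ α

theorem embedsIn_of_finite {V : Set ℝ} (hV : IsTruthValueSet V) (hfin : V.Finite) {C : Type*}
    [LinearOrder C] [Finite C] (hcard : Nat.card C ≤ V.ncard) {b t : C} (hbt : b < t)
    (hb : ∀ x, b ≤ x) (ht : ∀ x, x ≤ t) : EmbedsIn V C b t := by
  classical
  let F := hfin.toFinset
  have hF : F.card = V.ncard := (Set.ncard_eq_toFinset_card _ hfin).symm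
  let e := F.orderEmbOfFin hF
  have heV : ∀ i, e i ∈ V := fun i => hfin.mem_toFinset.1 (F.orderEmbOfFin_mem hF i)
  let rank : C → ℕ := fun x => (Set.Iio x).ncard
  have hrank : StrictMono rank := fun x y hxy =>
    Set.ncard_lt_ncard (Set.Iio_ssubset_Iio_iff.2 hxy) (Set.toFinite _)
  have hlt : ∀ x, rank x < V.ncard := fun x => by
    refine lt_of_lt_of_le ?_ hcard
    rw [← Set.ncard_univ]
    exact Set.ncard_lt_ncard (Set.ssubset_univ_iff.2 fun h =>
      lt_irrefl x (h.symm ▸ Set.mem_univ x : x ∈ Set.Iio x)) (Set.toFinite _)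
  have hrb : rank b = 0 := by
    have : Set.Iio b = ∅ := Set.eq_empty_of_forall_notMem fun x hx => not_lt.2 (hb x) hx
    simp [rank, this]
  have hrt : 0 < rank t := hrb ▸ hrank hbt
  have hbelow : ∀ x < t, e ⟨rank x, hlt x⟩ ≤ e ⟨rank t - 1, (Nat.sub_le _ _).trans_lt (hlt t)⟩ := by
    intro x hx
    refine e.monotone ?_
    have := hrank hx
    simp only [Fin.mk_le_mk]
    omega
  have hα : e ⟨rank t - 1, (Nat.sub_le _ _).trans_lt (hlt t)⟩ < 1 := by
    refine lt_of_lt_of_le (e.strictMono (b := ⟨rank t, hlt t⟩) ?_) (hV.subset_Icc (heV _)).2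
    simp only [Fin.mk_lt_mk]
    omega
  have hlt1 : ∀ x < t, e ⟨rank x, hlt x⟩ < 1 := fun x hx => (hbelow x hx).trans_lt hα
  refine ⟨fun x => if x = t then 1 else e ⟨rank x, hlt x⟩, ?_, ?_, ?_, by simp, _, hα, ?_⟩
  · intro x y hxy
    have hx : x < t := hxy.trans_le (ht y)
    by_cases hy : y = t
    · simpa [hx.ne, hy] using hlt1 x hx
    · simpa [hx.ne, hy] using hrank hxy
  · intro x
    dsimp only
    split_ifs
    · exact hV.one_mem
    · exact heV _
  · dsimp only
    rw [if_neg hbt.ne]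
    refine le_antisymm ?_ (hV.subset_Icc (heV _)).1
    have h0 : (0 : ℝ) ∈ Set.range e := by
      rw [Finset.range_orderEmbOfFin]
      exact hfin.mem_toFinset.2 hV.zero_mem
    obtain ⟨j, hj⟩ := h0
    rw [← hj]
    exact e.monotone (Fin.mk_le_of_le_val (by omega))
  · intro x hx
    dsimp only
    rw [if_neg hx.ne]
    exact hbelow x hx

/-- In every set of reals all but countably many points are condensation points from the right. -/
theorem countable_not_right_condensation (V : Set ℝ) :
    {x ∈ V | ∃ y > x, (V ∩ Set.Ioo x y).Countable}.Countable := by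
  have hsub : {x ∈ V | ∃ y > x, (V ∩ Set.Ioo x y).Countable} ⊆
      ⋃ q : ℚ, {x ∈ V | x < q ∧ (V ∩ Set.Ioo x q).Countable} := by
    rintro x ⟨hx, y, hxy, hc⟩
    obtain ⟨q, hq, hq'⟩ := exists_rat_btwn hxy
    exact Set.mem_iUnion.2 ⟨q, hx, hq,
      hc.mono (Set.inter_subset_inter_right _ (Set.Ioo_subset_Ioo_right hq'.le))⟩
  refine Set.Countable.mono hsub (Set.countable_iUnion fun q => ?_)
  set N := {x ∈ V | x < q ∧ (V ∩ Set.Ioo x q).Countable} with hN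
  -- By the Lindelöf property countably many of the intervals `(x, q)` with `x ∈ N` have the same
  -- union as all of them; this union misses at most the minimum of `N`.
  obtain ⟨M, hM, hMU⟩ := TopologicalSpace.isOpen_iUnion_countable
    (fun x : N => Set.Ioo (x : ℝ) q) (fun _ => isOpen_Ioo)
  have hcov : N ⊆ (⋃ x ∈ M, V ∩ Set.Ioo (x : ℝ) q) ∪ {x ∈ N | ∀ y ∈ N, x ≤ y} := by
    intro x hx
    by_cases hmin : ∀ y ∈ N, x ≤ y
    · exact Or.inr ⟨hx, hmin⟩
    · push Not at hmin
      obtain ⟨y, hy, hyx⟩ := hmin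
      have : x ∈ ⋃ x ∈ M, Set.Ioo (x : ℝ) q := by
        rw [hMU]
        exact Set.mem_iUnion.2 ⟨⟨y, hy⟩, hyx, hx.2.1⟩
      simp only [Set.mem_iUnion] at this
      obtain ⟨z, hz, hxz⟩ := this
      exact Or.inl (Set.mem_iUnion₂.2 ⟨z, hz, hx.1, hxz⟩)
  refine Set.Countable.mono hcov ((hM.biUnion fun x _ => x.2.2.2).union ?_)
  exact Set.Subsingleton.countable fun x hx y hy => le_antisymm (hx.2 y hy.1) (hy.2 x hx.1)

theorem countable_not_left_condensation (V : Set ℝ) :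
    {x ∈ V | ∃ y < x, (V ∩ Set.Ioo y x).Countable}.Countable := by
  refine Set.Countable.mono ?_ ((countable_not_right_condensation (-V)).image Neg.neg)
  rintro x ⟨hx, y, hyx, hc⟩
  refine ⟨-x, ⟨by simpa using hx, -y, neg_lt_neg hyx, ?_⟩, neg_neg x⟩
  refine (hc.image Neg.neg).mono ?_
  rintro z ⟨hz, hz₁, hz₂⟩
  exact ⟨-z, ⟨hz, by linarith, by linarith⟩, neg_neg z⟩

/-- An uncountable set of reals contains a set which is densely ordered by the order of `ℝ`: its
two-sided condensation points. -/
theorem exists_densely_ordered_subset {V : Set ℝ} (hV : ¬ V.Countable) :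
    ∃ W ⊆ V, ¬ W.Countable ∧ ∀ x ∈ W, ∀ y ∈ W, x < y → ∃ z ∈ W, x < z ∧ z < y := by
  set N := {x ∈ V | ∃ y > x, (V ∩ Set.Ioo x y).Countable} ∪
    {x ∈ V | ∃ y < x, (V ∩ Set.Ioo y x).Countable} with hN
  have hNc : N.Countable :=
    (countable_not_right_condensation V).union (countable_not_left_condensation V)
  refine ⟨V \ N, Set.sdiff_subset, fun h => hV ?_, ?_⟩
  · exact (h.union hNc).mono fun x hx => (em (x ∈ N)).elim Or.inr fun hn => Or.inl ⟨hx, hn⟩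
  · rintro x ⟨hx, hxN⟩ y - hxy
    have hunc : ¬ (V ∩ Set.Ioo x y).Countable := fun hc => hxN (Or.inl ⟨hx, y, hxy, hc⟩)
    by_contra! hno
    refine hunc (hNc.mono fun z hz => ?_)
    by_contra hzN
    exact absurd hz.2.2 (not_lt.2 (hno z ⟨hz.1, hzN⟩ hz.2.1))

theorem embedsIn_of_not_countable {V : Set ℝ} (hV : IsTruthValueSet V) (hunc : ¬ V.Countable)
    {C : Type*} [LinearOrder C] [Countable C] {b t : C} (hbt : b < t) (hb : ∀ x, b ≤ x)
    (ht : ∀ x, x ≤ t) : EmbedsIn V C b t := by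
  classical
  obtain ⟨W, hWV, hWunc, hW⟩ := exists_densely_ordered_subset hunc
  have hlt : ∃ x ∈ W, ∃ y ∈ W, x < y := by
    by_contra! hno
    exact hWunc (Set.Subsingleton.countable fun x hx y hy =>
      le_antisymm (hno y hy x hx) (hno x hx y hy))
  obtain ⟨x, hx, y', hy', hxy'⟩ := hlt
  -- All points strictly between `x` and `y` are bounded away from `1` by `y`.
  obtain ⟨y, hy, hxy, hyy'⟩ := hW x hx y' hy' hxy'
  have hy1 : y < 1 := hyy'.trans_le (hV.subset_Icc (hWV hy')).2
  have hx0 : 0 ≤ x := (hV.subset_Icc (hWV hx)).1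
  let U : Set ℝ := W ∩ Set.Ioo x y
  have hdense : DenselyOrdered U := ⟨fun p q hpq => by
    obtain ⟨z, hz, hpz, hzq⟩ := hW p p.2.1 q q.2.1 hpq
    exact ⟨⟨z, hz, p.2.2.1.trans hpz, hzq.trans q.2.2.2⟩, hpz, hzq⟩⟩
  have hnontriv : Nontrivial U := by
    obtain ⟨z, hz, hxz, hzy⟩ := hW x hx y hy hxy
    obtain ⟨z', hz', hxz', hzz'⟩ := hW x hx z hz hxz
    exact ⟨⟨⟨z, hz, hxz, hzy⟩, ⟨z', hz', hxz', hzz'.trans hzy⟩, fun h =>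
      hzz'.ne' (congrArg Subtype.val h)⟩⟩
  obtain ⟨f⟩ := Order.embedding_from_countable_to_dense C U
  have hfx : ∀ c, 0 < (f c : ℝ) := fun c => hx0.trans_lt (f c).2.2.1
  have hfy : ∀ c, (f c : ℝ) < y := fun c => (f c).2.2.2
  refine ⟨fun c => if c = t then 1 else if c = b then 0 else f c, ?_, ?_, by simp [hbt.ne],
    by simp, y, hy1, ?_⟩
  · intro c d hcd
    have hct : c ≠ t := (hcd.trans_le (ht d)).ne
    have hdb : d ≠ b := ((hb c).trans_lt hcd).ne'
    by_cases hdt : d = t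
    · by_cases hcb : c = b
      · simp [hdt, hcb, hbt.ne]
      · simpa [hdt, hct, hcb] using (hfy c).trans hy1
    · by_cases hcb : c = b
      · simpa [hcb, hbt.ne, hdt, hdb] using hfx d
      · simpa [hct, hcb, hdt, hdb] using hcd
  · intro c
    dsimp only
    split_ifs
    · exact hV.one_mem
    · exact hV.zero_mem
    · exact hWV (f c).2.1
  · intro c hc
    dsimp only
    rw [if_neg hc.ne]
    split_ifs
    · exact hx0.trans hxy.le
    · exact (hfy c).le

/-! ### Gödel numbers -/

section Coding

variable [Encodable (Σ n, L.Functions n)]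

theorem termCode_injective : Function.Injective (termCode (L := L)) := by
  intro t
  induction t with
  | var k =>
    intro t' h
    cases t' with
    | var k' =>
      simp only [termCode] at h
      rw [show k = k' by omega]
    | func f ts =>
      simp only [termCode] at h
      omega
  | @func n f ts ih =>
    intro t' h
    cases t' with
    | var k' =>
      simp only [termCode] at h
      omega
    | @func n' f' ts' =>
      simp only [termCode, Nat.add_right_cancel_iff, Nat.mul_left_cancel_iff two_pos,
        Nat.pair_eq_pair, Encodable.encode_inj] at h
      obtain ⟨hf, hts⟩ := h
      cases hf
      rw [funext fun i => ih i (congrFun (List.ofFn_injective hts) i)]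

variable [Encodable (Σ n, L.Relations n)]

theorem Formula.code_injective : Function.Injective (Formula.code (L := L)) := by
  intro φ
  induction φ with
  | bot => intro ψ h; cases ψ <;> simp only [Formula.code] at h <;> first | rfl | omega
  | @rel n R ts =>
    intro ψ h
    cases ψ <;> simp only [Formula.code] at h <;> try omega
    simp only [Nat.add_right_cancel_iff, Nat.mul_left_cancel_iff (show 0 < 7 by norm_num),
        Nat.pair_eq_pair, Encodable.encode_inj] at h
    obtain ⟨hf, hts⟩ := h
    cases hf
    rw [funext fun i => termCode_injective (congrFun (List.ofFn_injective hts) i)]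
  | and φ ψ ih₁ ih₂ | or φ ψ ih₁ ih₂ | imp φ ψ ih₁ ih₂ =>
    intro χ h
    cases χ <;> simp only [Formula.code] at h <;> try omega
    simp only [Nat.add_right_cancel_iff, Nat.mul_left_cancel_iff (show 0 < 7 by norm_num),
        Nat.pair_eq_pair] at h
    rw [ih₁ h.1, ih₂ h.2]
  | all φ ih | ex φ ih =>
    intro χ h
    cases χ <;> simp only [Formula.code] at h <;> try omega
    rw [ih (Nat.mul_left_cancel (show 0 < 7 by norm_num) (Nat.add_right_cancel h))]

end Coding

theorem countable_formula [Countable (Σ n, L.Functions n)] [Countable (Σ n, L.Relations n)] :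
    Countable (Formula L) := by
  have := Encodable.ofCountable (Σ n, L.Functions n)
  have := Encodable.ofCountable (Σ n, L.Relations n)
  exact Formula.code_injective.countable

/-! ### The chain of a prime theory -/

/-- The additional axioms `T` suffice for the truth value set `V`: none are needed if `V` is
uncountable, and the characteristic axioms of `V` are available if `V` is finite. -/
def Adequate (V : Set ℝ) (T : Set (Formula L)) : Prop :=
  (V.Finite ∧ charAxioms L V.ncard ⊆ T) ∨ ¬ V.Countable

/-- A valuation that respects the propositional connectives (quantified formulas are treated as
atoms) and keeps every formula of `Γ` below a bound smaller than `1` exists as soon as no finite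
disjunction of members of `Γ` is derivable. -/
theorem exists_valuation [Countable (Formula L)] {V : Set ℝ} (hV : IsTruthValueSet V)
    {T : Set (Formula L)} (hVT : Adequate V T) {Γ : Set (Formula L)}
    (hΓ : ∀ l : List (Formula L), (∀ A ∈ l, A ∈ Γ) → ¬ Derivable T (disj l)) :
    ∃ h : Formula L → ℝ, (∀ A, h A ∈ V) ∧ h .bot = 0 ∧
      (∀ A B, h (.and A B) = min (h A) (h B)) ∧ (∀ A B, h (.or A B) = max (h A) (h B)) ∧
      (∀ A B, h (.imp A B) = if h A > h B then h B else 1) ∧ ∃ α < 1, ∀ A ∈ Γ, h A ≤ α := by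
  classical
  obtain ⟨Θ, hΘ, hdisj, hbot, hprime⟩ := exists_prime_theory hΓ
  have hlin : ∀ A B, .imp A B ∈ Θ ∨ .imp B A ∈ Θ := fun A B =>
    hprime _ _ (hΘ.derivable_mem (.linear A B))
  -- Formulas are ordered by provable implication in the prime theory.
  let : Preorder (Formula L) :=
    { le := fun A B => .imp A B ∈ Θ
      le_refl := hΘ.imp_refl
      le_trans := fun _ _ _ h₁ h₂ => hΘ.imp_trans h₁ h₂ }
  have : Std.Total (α := Formula L) (· ≤ ·) := ⟨hlin⟩
  have le_def : ∀ A B : Formula L, A ≤ B ↔ .imp A B ∈ Θ := fun _ _ => Iff.rfl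
  let C := Antisymmetrization (Formula L) (· ≤ ·)
  let mk : Formula L → C := toAntisymmetrization (· ≤ ·)
  let top : Formula L := .imp .bot .bot
  have htop : ∀ A, top ≤ A ↔ A ∈ Θ := fun A =>
    ⟨fun h => hΘ.mp h (hΘ.imp_refl _), fun h => hΘ.weaken _ h⟩
  have hC : Function.Surjective mk := fun c => ⟨ofAntisymmetrization _ c, by simp [mk]⟩
  have hCcount : Countable C := hC.countable
  have mk_le : ∀ A B, mk A ≤ mk B ↔ A ≤ B := fun A B => Iff.rfl
  have mk_lt : ∀ A B, mk A < mk B ↔ ¬ B ≤ A := fun A B => by rw [← mk_le B A, not_le]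
  have hbt : mk .bot < mk top := by
    rw [mk_lt, htop]
    exact hbot
  have hb : ∀ c, mk .bot ≤ c := fun c => by
    obtain ⟨A, rfl⟩ := hC c
    exact hΘ.derivable_mem (.bot_elim A)
  have ht : ∀ c, c ≤ mk top := fun c => by
    obtain ⟨A, rfl⟩ := hC c
    exact hΘ.weaken _ (hΘ.imp_refl _)
  have hemb : EmbedsIn V C (mk .bot) (mk top) := by
    rcases hVT with ⟨hfin, hT⟩ | hunc
    · have key : ∀ f : Fin (V.ncard + 1) → C, ¬ Function.Injective f := by
        intro f hf
        choose A hA using fun i => hC (f i)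
        have hax := hΘ.derivable_mem (.ax (hT
          ⟨fun i => if hi : i < V.ncard + 1 then A ⟨i, hi⟩ else .bot, rfl⟩))
        obtain ⟨B, hB, hB'⟩ := exists_mem_of_bigOr_mem hbot hprime hax
        obtain ⟨i, hi, rfl⟩ := List.mem_map.1 hB
        obtain ⟨E, hE, hE'⟩ := exists_mem_of_bigOr_mem hbot hprime hB'
        obtain ⟨j, hj, rfl⟩ := List.mem_map.1 hE
        rw [List.mem_range] at hi
        rw [List.mem_range'_1] at hj
        have hi' : i < V.ncard + 1 := by omega
        have hj' : j < V.ncard + 1 := by omega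
        simp only [hi', hj', dif_pos] at hE'
        have heq : mk (A ⟨i, hi'⟩) = mk (A ⟨j, hj'⟩) := le_antisymm
          (hΘ.mp (hΘ.derivable_mem (.and_left _ _)) hE')
          (hΘ.mp (hΘ.derivable_mem (.and_right _ _)) hE')
        rw [hA, hA] at heq
        have := congrArg Fin.val (hf heq)
        simp only at this
        omega
      have hCfin : Finite C := by
        by_contra hinf
        rw [not_finite_iff_infinite] at hinf
        exact key (fun i => Infinite.natEmbedding C i) fun i j hij =>
          Fin.ext ((Infinite.natEmbedding C).injective hij)
      refine embedsIn_of_finite hV hfin ?_ hbt hb ht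
      by_contra! hcard
      let e := Finite.equivFin C
      exact key (fun i => e.symm (Fin.castLE hcard i)) fun i j hij => by simpa using hij
    · exact embedsIn_of_not_countable hV hunc hbt hb ht
  obtain ⟨g, hg, hgV, hg0, hg1, α, hα, hgα⟩ := hemb
  have g_eq : ∀ A B, A ≤ B → B ≤ A → g (mk A) = g (mk B) := fun A B h₁ h₂ =>
    congrArg g (le_antisymm h₁ h₂)
  have g_le : ∀ A B, g (mk A) ≤ g (mk B) ↔ .imp A B ∈ Θ := fun A B => hg.le_iff_le
  refine ⟨fun A => g (mk A), fun A => hgV _, hg0, fun A B => ?_, fun A B => ?_, fun A B => ?_,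
    α, hα, fun A hA => hgα _ ?_⟩
  · have h₁ := hΘ.derivable_mem (.and_left A B)
    have h₂ := hΘ.derivable_mem (.and_right A B)
    dsimp only
    rcases hlin A B with h | h
    · rw [min_eq_left ((g_le _ _).2 h)]
      exact g_eq _ _ h₁ (hΘ.imp_and (hΘ.imp_refl A) h)
    · rw [min_eq_right ((g_le _ _).2 h)]
      exact g_eq _ _ h₂ (hΘ.imp_and h (hΘ.imp_refl B))
  · have h₁ := hΘ.derivable_mem (.or_left A B)
    have h₂ := hΘ.derivable_mem (.or_right A B)
    dsimp only
    rcases hlin A B with h | h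
    · rw [max_eq_right ((g_le _ _).2 h)]
      exact g_eq _ _ (hΘ.or_imp h (hΘ.imp_refl B)) h₂
    · rw [max_eq_left ((g_le _ _).2 h)]
      exact g_eq _ _ (hΘ.or_imp (hΘ.imp_refl A) h) h₁
  · dsimp only
    split_ifs with hlt
    · have hAB : .imp A B ∉ Θ := fun h => not_le.2 hlt ((g_le _ _).2 h)
      refine g_eq _ _ ?_ (hΘ.derivable_mem (.imp_k B A))
      -- Linearity of `A` and `A → B` gives `(A → B) → A`, hence `(A → B) → B`.
      rcases hlin A (.imp A B) with h | h
      · exact absurd (hΘ.mp₂ h (hΘ.imp_refl A)) hAB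
      · exact hΘ.mp₂ (hΘ.imp_refl _) h
    · rw [← hg1]
      exact g_eq _ _ (ht (mk _)) ((htop _).2 ((g_le _ _).1 (not_lt.1 hlt)))
  · rw [mk_lt, htop]
    exact fun h => Set.disjoint_left.1 hdisj hA h

/-! ### Saturation -/

/-- The quantifier rules, read backwards: an instance can be added to an underivable disjunction.
The step treats the formula `ψ`, and adds the instance with `t` if `ψ` is existential. -/
theorem exists_saturation_step {T : Set (Formula L)} (l : List (Formula L))
    (hl : ¬ Derivable T (disj l)) (ψ : Formula L) (t : L.Term ℕ) :
    ∃ l' : List (Formula L), ¬ Derivable T (disj l') ∧ l ⊆ l' ∧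
      (∀ A, ψ = .all A → ψ ∈ l → ∃ y, A.inst (.var y) ∈ l') ∧
      (∀ A, ψ = .ex A → ψ ∈ l → A.inst t ∈ l') := by
  have hder := isTheory_derivable T
  have hcontr : ∀ A, A ∈ l → ¬ Derivable T (.or A (disj l)) := fun A hA h =>
    hl (hder.mp (hder.or_imp (hder.imp_disj hA) (hder.imp_refl _)) h)
  by_cases hψ : ψ ∈ l
  swap
  · exact ⟨l, hl, fun _ h => h, fun _ _ h => absurd h hψ, fun _ _ h => absurd h hψ⟩
  cases ψ with
  | all A =>
    obtain ⟨y, hy⟩ := (Formula.all (.or A (disj l).lift)).exists_fresh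
    refine ⟨A.inst (.var y) :: l, fun h => hcontr _ hψ (.all_or (.all_intro y (hy y le_rfl) ?_)),
      List.subset_cons_self _ _, ?_, by simp⟩
    · change Derivable T (.or (A.inst (.var y)) ((disj l).lift.inst (.var y)))
      rw [Formula.inst_lift]
      exact h
    · rintro B hB -
      cases hB
      exact ⟨y, by simp⟩
  | ex A =>
    refine ⟨A.inst t :: l, fun h => hcontr _ hψ (.ex_or (.ex_intro t ?_)),
      List.subset_cons_self _ _, by simp, ?_⟩
    · change Derivable T (.or (A.inst t) ((disj l).lift.inst t))
      rw [Formula.inst_lift]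
      exact h
    · rintro B hB -
      cases hB
      simp
  | bot | rel | and | or | imp => exact ⟨l, hl, fun _ h => h, by simp, by simp⟩

theorem exists_saturated [Countable (Formula L)] [Countable (L.Term ℕ)] {T : Set (Formula L)}
    {φ : Formula L} (hφ : ¬ Derivable T φ) :
    ∃ Γ : Set (Formula L), φ ∈ Γ ∧
      (∀ l : List (Formula L), (∀ A ∈ l, A ∈ Γ) → ¬ Derivable T (disj l)) ∧
      (∀ A, .all A ∈ Γ → ∃ y, A.inst (.var y) ∈ Γ) ∧
      (∀ A, .ex A ∈ Γ → ∀ t, A.inst t ∈ Γ) := by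
  have hder := isTheory_derivable T
  have : Nonempty (Formula L × L.Term ℕ) := ⟨.bot, .var 0⟩
  obtain ⟨f, hf⟩ := exists_surjective_nat (Formula L × L.Term ℕ)
  choose next hnext hsub hall hex using
    fun (l : {l : List (Formula L) // ¬ Derivable T (disj l)}) (p : Formula L × L.Term ℕ) =>
      exists_saturation_step l.1 l.2 p.1 p.2
  -- Stage `Nat.pair i k` treats the task number `i`; every task recurs at arbitrarily late stages.
  let stage : ℕ → {l : List (Formula L) // ¬ Derivable T (disj l)} := fun n =>
    n.rec ⟨[φ], fun h => hφ (hder.mp (hder.or_imp (hder.imp_refl φ)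
      (hder.derivable_mem (.bot_elim φ))) h)⟩
      fun n l => ⟨next l (f n.unpair.1), hnext l (f n.unpair.1)⟩
  have hmono : ∀ {i j}, i ≤ j → (stage i).1 ⊆ (stage j).1 := fun {i j} hij => by
    induction j, hij using Nat.le_induction with
    | base => exact fun _ h => h
    | succ j _ ih => exact fun _ h => hsub _ _ (ih h)
  have htask : ∀ ψ t i, ∃ j : ℕ, i ≤ j ∧ f j.unpair.1 = (ψ, t) := fun ψ t i => by
    obtain ⟨k, hk⟩ := hf (ψ, t)
    exact ⟨Nat.pair k i, Nat.right_le_pair k i, by simpa using hk⟩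
  refine ⟨{A | ∃ n, A ∈ (stage n).1}, ⟨0, by simp [stage]⟩, ?_, ?_, ?_⟩
  · intro l hl hd
    have : ∃ n, l ⊆ (stage n).1 := by
      clear hd
      induction l with
      | nil => exact ⟨0, by simp⟩
      | cons A l ih =>
        obtain ⟨n, hn⟩ := ih fun B hB => hl B (by simp [hB])
        obtain ⟨k, hk⟩ := hl A (by simp)
        exact ⟨max n k, List.cons_subset.2 ⟨hmono (le_max_right _ _) hk,
          fun _ h => hmono (le_max_left _ _) (hn h)⟩⟩
    obtain ⟨n, hn⟩ := this
    exact (stage n).2 (hder.disj_mono hn hd)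
  · rintro A ⟨i, hi⟩
    obtain ⟨j, hj, e⟩ := htask (.all A) (.var 0) i
    obtain ⟨y, hy⟩ := hall (stage j) (f j.unpair.1) A (by rw [e]) (by rw [e]; exact hmono hj hi)
    exact ⟨y, j + 1, hy⟩
  · rintro A ⟨i, hi⟩ t
    obtain ⟨j, hj, e⟩ := htask (.ex A) t i
    have := hex (stage j) (f j.unpair.1) A (by rw [e]) (by rw [e]; exact hmono hj hi)
    rw [e] at this
    exact ⟨j + 1, by simpa [stage, e] using this⟩

/-! ### The term model -/

/-- Completeness for countable languages. The terms are the individuals of the countermodel. -/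
theorem derivable_of_valid_of_countable [Countable (Σ n, L.Functions n)]
    [Countable (Σ n, L.Relations n)] {V : Set ℝ} (hV : IsTruthValueSet V) {T : Set (Formula L)}
    (hVT : Adequate V T) {φ : Formula L} (hφ : φ.IsPrenex) (hvalid : Valid.{u, v, w} V φ) :
    Derivable T φ := by
  have := countable_formula (L := L)
  by_contra hnot
  obtain ⟨Γ, hφΓ, hΓ, hall, hex⟩ := exists_saturated hnot
  obtain ⟨h, hhV, hbot, hand, hor, himp, α, hα, hhα⟩ := exists_valuation hV hVT hΓ
  have : Infinite (L.Term ℕ) := Infinite.of_injective Term.var fun _ _ h => by cases h; rfl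
  -- A copy of the set of terms in the universe in which the domains live.
  obtain ⟨e⟩ : Nonempty (L.Term ℕ ≃ ULift.{w} ℕ) := nonempty_equiv_of_countable
  let I : Interpretation L V (ULift.{w} ℕ) :=
    { func := fun f args => e (.func f fun i => e.symm (args i))
      rel := fun R args => ⟨h (.rel R fun i => e.symm (args i)), hhV _⟩ }
  have hterm : ∀ (σ : ℕ → L.Term ℕ) (t : L.Term ℕ),
      I.termValue (fun k => e (σ k)) t = e (t.subst σ) := by
    intro σ t
    induction t with
    | var k => rfl
    | func f ts ih => simp [Interpretation.termValue, I, ih, Term.subst]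
  have hqf : ∀ ψ : Formula L, ψ.QuantifierFree → ∀ σ : ℕ → L.Term ℕ,
      I.value ψ (fun k => e (σ k)) = h (ψ.subst σ) := by
    intro ψ hψ σ
    induction ψ with
    | bot => exact hbot.symm
    | rel R ts => simp [Interpretation.value, hterm, Formula.subst, I]
    | and A B ih₁ ih₂ | or A B ih₁ ih₂ | imp A B ih₁ ih₂ =>
      simp [Interpretation.value, Formula.subst, hand, hor, himp, ih₁ hψ.1, ih₂ hψ.2]
    | all A | ex A => exact hψ.elim
  have hcons : ∀ (t : L.Term ℕ) (σ : ℕ → L.Term ℕ) (A : Formula L),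
      (A.subst (upSubst σ)).inst t = A.subst (fun k => Nat.casesOn k t σ) := by
    intro t σ A
    rw [Formula.inst, Formula.subst_subst]
    congr 1
    funext k
    cases k with
    | zero => rfl
    | succ k =>
      simp only [upSubst, term_relabel_eq_subst, term_subst_subst]
      exact term_subst_var _
  have hval : ∀ (t : L.Term ℕ) (σ : ℕ → L.Term ℕ),
      consVal (e t) (fun k => e (σ k)) = fun k => e (Nat.casesOn k t σ) := by
    intro t σ
    funext k
    cases k <;> rfl
  have hprenex : ∀ ψ : Formula L, ψ.IsPrenex → ∀ σ : ℕ → L.Term ℕ, ψ.subst σ ∈ Γ →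
      I.value ψ (fun k => e (σ k)) ≤ α := by
    intro ψ hψ
    induction hψ with
    | of_quantifierFree hq =>
      intro σ hσ
      rw [hqf _ hq]
      exact hhα _ hσ
    | @all A _ ih =>
      intro σ hσ
      obtain ⟨y, hy⟩ := hall _ hσ
      rw [hcons] at hy
      refine le_trans (ciInf_le ⟨0, ?_⟩ (e (.var y))) ?_
      · rintro _ ⟨d, rfl⟩
        exact I.value_nonneg hV _ _
      · rw [hval]
        exact ih _ hy
    | @ex A _ ih =>
      intro σ hσ
      refine ciSup_le fun d => ?_
      have ht := hex _ hσ (e.symm d)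
      rw [hcons] at ht
      have := ih _ ht
      rwa [← hval, e.apply_symm_apply] at this
  have hle := hprenex φ hφ Term.var (by rwa [Formula.subst_var])
  rw [hvalid] at hle
  exact absurd hle (not_le.2 hα)

variable {L' : FirstOrder.Language.{u, v}}

/-! ### Reduction to countable languages -/

/-- The formula over `L` obtained by renaming the symbols of a formula over `L'`. -/
def Formula.map (F : L' →ᴸ L) : Formula L' → Formula L
  | .bot => .bot
  | .rel R ts => .rel (F.onRelation R) fun i => F.onTerm (ts i)
  | .and φ ψ => .and (φ.map F) (ψ.map F)
  | .or φ ψ => .or (φ.map F) (ψ.map F)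
  | .imp φ ψ => .imp (φ.map F) (ψ.map F)
  | .all φ => .all (φ.map F)
  | .ex φ => .ex (φ.map F)

section Map

variable (F : L' →ᴸ L)

theorem onTerm_subst (t : L'.Term ℕ) (σ : ℕ → L'.Term ℕ) :
    F.onTerm (t.subst σ) = (F.onTerm t).subst fun k => F.onTerm (σ k) := by
  induction t with
  | var k => rfl
  | func f ts ih => simp [Term.subst, FirstOrder.Language.LHom.onTerm, ih]

theorem varFinset_onTerm (t : L'.Term ℕ) : (F.onTerm t).varFinset = t.varFinset := by
  induction t with
  | var k => rfl
  | func f ts ih => simp [Term.varFinset, FirstOrder.Language.LHom.onTerm, ih]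

theorem Formula.map_subst (φ : Formula L') (σ : ℕ → L'.Term ℕ) :
    (φ.subst σ).map F = (φ.map F).subst fun k => F.onTerm (σ k) := by
  have key : ∀ σ : ℕ → L'.Term ℕ,
      (fun k => F.onTerm (upSubst σ k)) = upSubst fun k => F.onTerm (σ k) := by
    intro σ
    funext k
    cases k with
    | zero => rfl
    | succ k =>
      simp only [upSubst, term_relabel_eq_subst, onTerm_subst]
      rfl
  induction φ generalizing σ with
  | bot => rfl
  | rel R ts => simp [Formula.subst, Formula.map, onTerm_subst]
  | and φ ψ ih₁ ih₂ | or φ ψ ih₁ ih₂ | imp φ ψ ih₁ ih₂ =>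
    simp [Formula.subst, Formula.map, ih₁, ih₂]
  | all φ ih | ex φ ih => simp [Formula.subst, Formula.map, ih, key]

theorem Formula.map_inst (φ : Formula L') (t : L'.Term ℕ) :
    (φ.inst t).map F = (φ.map F).inst (F.onTerm t) := by
  rw [Formula.inst, Formula.map_subst, Formula.inst]
  congr 1
  funext k
  cases k <;> rfl

theorem Formula.map_lift (φ : Formula L') : φ.lift.map F = (φ.map F).lift :=
  φ.map_subst F _

theorem Formula.freeIn_map (φ : Formula L') (y : ℕ) : (φ.map F).FreeIn y ↔ φ.FreeIn y := by
  induction φ generalizing y with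
  | bot => rfl
  | rel R ts => simp [Formula.map, Formula.FreeIn, varFinset_onTerm]
  | and φ ψ ih₁ ih₂ | or φ ψ ih₁ ih₂ | imp φ ψ ih₁ ih₂ =>
    simp [Formula.map, Formula.FreeIn, ih₁, ih₂]
  | all φ ih | ex φ ih => simp [Formula.map, Formula.FreeIn, ih]

theorem Derivable.map {T : Set (Formula L)} {T' : Set (Formula L')}
    (hT : ∀ A ∈ T', A.map F ∈ T) {φ : Formula L'} (h : Derivable T' φ) :
    Derivable T (φ.map F) := by
  induction h with
  | ax h => exact .ax (hT _ h)
  | imp_k A B => exact .imp_k _ _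
  | imp_s A B C => exact .imp_s _ _ _
  | and_left A B => exact .and_left _ _
  | and_right A B => exact .and_right _ _
  | and_intro A B => exact .and_intro _ _
  | or_left A B => exact .or_left _ _
  | or_right A B => exact .or_right _ _
  | or_elim A B C => exact .or_elim _ _ _
  | bot_elim A => exact .bot_elim _
  | linear A B => exact .linear _ _
  | mp _ _ ih₁ ih₂ => exact .mp ih₁ ih₂
  | @all_intro A y hy _ ih =>
    refine .all_intro y (fun h => hy ((A.freeIn_map F _).1 h)) ?_
    rwa [Formula.map_inst] at ih
  | @ex_intro A t _ ih =>
    refine .ex_intro (F.onTerm t) ?_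
    rwa [Formula.map_inst] at ih
  | @all_or A B _ ih =>
    refine .all_or ?_
    simp only [Formula.map, Formula.map_lift] at ih
    exact ih
  | @ex_or A B _ ih =>
    refine .ex_or ?_
    simp only [Formula.map, Formula.map_lift] at ih
    exact ih

theorem map_mem_charAxioms (m : ℕ) {A : Formula L'} (hA : A ∈ charAxioms L' m) :
    A.map F ∈ charAxioms L m := by
  obtain ⟨B, rfl⟩ := hA
  exact ⟨fun i => (B i).map F, map_charFormula (Formula.map F) rfl (fun _ _ => rfl)
    (fun _ _ => rfl) (fun _ _ => rfl) m B⟩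

theorem Formula.quantifierFree_of_map (φ : Formula L') (h : (φ.map F).QuantifierFree) :
    φ.QuantifierFree := by
  induction φ with
  | bot | rel => trivial
  | and φ ψ ih₁ ih₂ | or φ ψ ih₁ ih₂ | imp φ ψ ih₁ ih₂ => exact ⟨ih₁ h.1, ih₂ h.2⟩
  | all φ ih | ex φ ih => exact h

theorem Formula.isPrenex_of_map (φ : Formula L') (h : (φ.map F).IsPrenex) : φ.IsPrenex := by
  induction φ with
  | bot | rel => exact .of_quantifierFree trivial
  | and φ ψ ih₁ ih₂ | or φ ψ ih₁ ih₂ | imp φ ψ ih₁ ih₂ =>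
    cases h with
    | of_quantifierFree h => exact .of_quantifierFree (Formula.quantifierFree_of_map F _ h)
  | all φ ih =>
    cases h with
    | of_quantifierFree h => exact h.elim
    | all h => exact .all (ih h)
  | ex φ ih =>
    cases h with
    | of_quantifierFree h => exact h.elim
    | ex h => exact .ex (ih h)

end Map

/-- The function symbols of a term. -/
def termFuns : L.Term ℕ → Set (Σ n, L.Functions n)
  | .var _ => ∅
  | @FirstOrder.Language.Term.func _ _ n f ts => insert ⟨n, f⟩ (⋃ i, termFuns (ts i))

/-- The function symbols of a formula. -/
def Formula.funs : Formula L → Set (Σ n, L.Functions n)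
  | .bot => ∅
  | .rel _ ts => ⋃ i, termFuns (ts i)
  | .and φ ψ | .or φ ψ | .imp φ ψ => φ.funs ∪ ψ.funs
  | .all φ | .ex φ => φ.funs

/-- The predicate symbols of a formula. -/
def Formula.rels : Formula L → Set (Σ n, L.Relations n)
  | .bot => ∅
  | @Formula.rel _ n R _ => {⟨n, R⟩}
  | .and φ ψ | .or φ ψ | .imp φ ψ => φ.rels ∪ ψ.rels
  | .all φ | .ex φ => φ.rels

theorem countable_termFuns (t : L.Term ℕ) : (termFuns t).Countable := by
  induction t with
  | var k => exact Set.countable_empty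
  | func f ts ih => exact (Set.countable_iUnion ih).insert _

theorem Formula.countable_funs (φ : Formula L) : φ.funs.Countable := by
  induction φ with
  | bot => exact Set.countable_empty
  | rel R ts => exact Set.countable_iUnion fun i => countable_termFuns (ts i)
  | and φ ψ ih₁ ih₂ | or φ ψ ih₁ ih₂ | imp φ ψ ih₁ ih₂ => exact ih₁.union ih₂
  | all φ ih | ex φ ih => exact ih

theorem Formula.countable_rels (φ : Formula L) : φ.rels.Countable := by
  induction φ with
  | bot => exact Set.countable_empty
  | rel R ts => exact Set.countable_singleton _
  | and φ ψ ih₁ ih₂ | or φ ψ ih₁ ih₂ | imp φ ψ ih₁ ih₂ => exact ih₁.union ih₂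
  | all φ ih | ex φ ih => exact ih

section SubLanguage

variable (P : Set (Σ n, L.Functions n)) (Q : Set (Σ n, L.Relations n))

/-- The language with the function symbols in `P` and the predicate symbols in `Q`. -/
def subLanguage : FirstOrder.Language.{u, v} where
  Functions n := {f : L.Functions n // (⟨n, f⟩ : Σ n, L.Functions n) ∈ P}
  Relations n := {R : L.Relations n // (⟨n, R⟩ : Σ n, L.Relations n) ∈ Q}

/-- The inclusion of a sublanguage. -/
def subLanguageIncl : subLanguage P Q →ᴸ L where
  onFunction _ f := f.1
  onRelation _ R := R.1

variable {P Q}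

theorem countable_functions_subLanguage (hP : P.Countable) :
    Countable (Σ n, (subLanguage P Q).Functions n) := by
  have := hP.to_subtype
  refine Function.Injective.countable (β := P) (f := fun x => ⟨⟨x.1, x.2.1⟩, x.2.2⟩) ?_
  rintro ⟨n, f, hf⟩ ⟨n', f', hf'⟩ h
  cases h
  rfl

theorem countable_relations_subLanguage (hQ : Q.Countable) :
    Countable (Σ n, (subLanguage P Q).Relations n) := by
  have := hQ.to_subtype
  refine Function.Injective.countable (β := Q) (f := fun x => ⟨⟨x.1, x.2.1⟩, x.2.2⟩) ?_
  rintro ⟨n, f, hf⟩ ⟨n', f', hf'⟩ h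
  cases h
  rfl

theorem exists_onTerm_eq (t : L.Term ℕ) (h : termFuns t ⊆ P) :
    ∃ t' : (subLanguage P Q).Term ℕ, (subLanguageIncl P Q).onTerm t' = t := by
  induction t with
  | var k => exact ⟨.var k, rfl⟩
  | @func n f ts ih =>
    obtain ⟨hf, hts⟩ := Set.insert_subset_iff.1 h
    choose ts' hts' using fun i => ih i ((Set.subset_iUnion _ i).trans hts)
    refine ⟨FirstOrder.Language.Term.func (L := subLanguage P Q) ⟨f, hf⟩ ts', ?_⟩
    simp only [FirstOrder.Language.LHom.onTerm, hts']
    rfl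

theorem Formula.exists_map_eq (φ : Formula L) (hP : φ.funs ⊆ P) (hQ : φ.rels ⊆ Q) :
    ∃ φ' : Formula (subLanguage P Q), φ'.map (subLanguageIncl P Q) = φ := by
  induction φ with
  | bot => exact ⟨.bot, rfl⟩
  | @rel n R ts =>
    choose ts' hts' using fun i =>
      exists_onTerm_eq (Q := Q) (ts i) ((Set.subset_iUnion _ i).trans hP)
    refine ⟨Formula.rel (L := subLanguage P Q) ⟨R, hQ rfl⟩ ts', ?_⟩
    simp only [Formula.map, hts']
    rfl
  | and φ ψ ih₁ ih₂ =>
    obtain ⟨φ', rfl⟩ := ih₁ (Set.subset_union_left.trans hP) (Set.subset_union_left.trans hQ)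
    obtain ⟨ψ', rfl⟩ := ih₂ (Set.subset_union_right.trans hP) (Set.subset_union_right.trans hQ)
    exact ⟨.and φ' ψ', rfl⟩
  | or φ ψ ih₁ ih₂ =>
    obtain ⟨φ', rfl⟩ := ih₁ (Set.subset_union_left.trans hP) (Set.subset_union_left.trans hQ)
    obtain ⟨ψ', rfl⟩ := ih₂ (Set.subset_union_right.trans hP) (Set.subset_union_right.trans hQ)
    exact ⟨.or φ' ψ', rfl⟩
  | imp φ ψ ih₁ ih₂ =>
    obtain ⟨φ', rfl⟩ := ih₁ (Set.subset_union_left.trans hP) (Set.subset_union_left.trans hQ)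
    obtain ⟨ψ', rfl⟩ := ih₂ (Set.subset_union_right.trans hP) (Set.subset_union_right.trans hQ)
    exact ⟨.imp φ' ψ', rfl⟩
  | all φ ih =>
    obtain ⟨φ', rfl⟩ := ih hP hQ
    exact ⟨.all φ', rfl⟩
  | ex φ ih =>
    obtain ⟨φ', rfl⟩ := ih hP hQ
    exact ⟨.ex φ', rfl⟩

/-- Every interpretation of a sublanguage expands to the whole language. -/
theorem Valid.of_map {V : Set ℝ} (hV : IsTruthValueSet V) {φ : Formula (subLanguage P Q)}
    (h : Valid.{u, v, w} V (φ.map (subLanguageIncl P Q))) : Valid.{u, v, w} V φ := by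
  classical
  intro D I s
  let J : Interpretation L V D :=
    { func := fun {n} f args => if hf : (⟨n, f⟩ : Σ n, L.Functions n) ∈ P then
        I.func (L := subLanguage P Q) ⟨f, hf⟩ args else s 0
      rel := fun {n} R args => if hR : (⟨n, R⟩ : Σ n, L.Relations n) ∈ Q then
        I.rel (L := subLanguage P Q) ⟨R, hR⟩ args else ⟨0, hV.zero_mem⟩ }
  have hterm : ∀ (t : (subLanguage P Q).Term ℕ) (s : ℕ → D),
      J.termValue s ((subLanguageIncl P Q).onTerm t) = I.termValue s t := by
    intro t s
    induction t with
    | var k => rfl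
    | func f ts ih =>
      simp only [FirstOrder.Language.LHom.onTerm, Interpretation.termValue, ih]
      exact dif_pos f.2
  have hval : ∀ (ψ : Formula (subLanguage P Q)) (s : ℕ → D),
      J.value (ψ.map (subLanguageIncl P Q)) s = I.value ψ s := by
    intro ψ s
    induction ψ generalizing s with
    | bot => rfl
    | rel R ts =>
      simp only [Formula.map, Interpretation.value, hterm]
      exact congrArg Subtype.val (dif_pos R.2)
    | and φ ψ ih₁ ih₂ | or φ ψ ih₁ ih₂ | imp φ ψ ih₁ ih₂ =>
      simp only [Formula.map, Interpretation.value, ih₁, ih₂]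
    | all φ ih | ex φ ih => simp only [Formula.map, Interpretation.value, ih]
  rw [← hval]
  exact h D J s

end SubLanguage

/-- Completeness for arbitrary languages: only the countably many symbols of a formula matter. -/
theorem derivable_of_valid {V : Set ℝ} (hV : IsTruthValueSet V) {φ : Formula L}
    (hφ : φ.IsPrenex) (hvalid : Valid.{u, v, w} V φ) :
    (V.Finite → Derivable (charAxioms L V.ncard) φ) ∧ (¬ V.Countable → Derivable ∅ φ) := by
  have := countable_functions_subLanguage (Q := φ.rels) φ.countable_funs
  have := countable_relations_subLanguage (P := φ.funs) φ.countable_rels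
  obtain ⟨φ', hφ'⟩ := φ.exists_map_eq (P := φ.funs) (Q := φ.rels) subset_rfl subset_rfl
  set P := φ.funs
  set Q := φ.rels
  rw [← hφ'] at hφ hvalid ⊢
  have hp := Formula.isPrenex_of_map _ _ hφ
  have hv := Valid.of_map hV hvalid
  refine ⟨fun hfin => ?_, fun hunc => ?_⟩
  · exact (derivable_of_valid_of_countable hV (Or.inl ⟨hfin, subset_rfl⟩) hp hv).map _
      fun _ hA => map_mem_charAxioms _ _ hA
  · exact (derivable_of_valid_of_countable (T := ∅) hV (Or.inr hunc) hp hv).map _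
      fun _ hA => hA.elim

/-! ### Recursive enumerability of rule closures -/

/-- The least set of natural numbers closed under the rules in `R`, where `(l, c)` is the rule that
infers `c` from the members of `l`. -/
inductive RuleClosure (R : Set (List ℕ × ℕ)) : ℕ → Prop
  | intro {l : List ℕ} {c : ℕ} : (l, c) ∈ R → (∀ x ∈ l, RuleClosure R x) → RuleClosure R c

/-- The rules in `R` are enumerated by a computable partial function. -/
def RulesEnumerable (R : Set (List ℕ × ℕ)) : Prop :=
  ∃ f : ℕ → Option (List ℕ × ℕ), Computable f ∧ ∀ r, r ∈ R ↔ ∃ n, f n = some r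

theorem RulesEnumerable.empty : RulesEnumerable ∅ :=
  ⟨fun _ => none, Computable.const none, by simp⟩

theorem RulesEnumerable.union {R R' : Set (List ℕ × ℕ)} (h : RulesEnumerable R)
    (h' : RulesEnumerable R') : RulesEnumerable (R ∪ R') := by
  obtain ⟨f, hf, hfR⟩ := h
  obtain ⟨g, hg, hgR⟩ := h'
  refine ⟨fun n => cond n.bodd (f n.div2) (g n.div2),
    Computable.cond Computable.nat_bodd (hf.comp Computable.nat_div2)
      (hg.comp Computable.nat_div2), fun r => ?_⟩
  rw [Set.mem_union, hfR, hgR]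
  constructor
  · rintro (⟨n, hn⟩ | ⟨n, hn⟩)
    · exact ⟨Nat.bit true n, by simpa using hn⟩
    · exact ⟨Nat.bit false n, by simpa using hn⟩
  · rintro ⟨n, hn⟩
    cases hb : n.bodd
    · exact Or.inr ⟨n.div2, by simpa [hb] using hn⟩
    · exact Or.inl ⟨n.div2, by simpa [hb] using hn⟩

/-- The conclusions obtained in the first stages of applying the rules enumerated by `f`. Stage
`Nat.pair i k` applies the rule number `i`, so that every rule recurs at arbitrarily late stages. -/
def conclusions (f : ℕ → Option (List ℕ × ℕ)) : ℕ → List ℕ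
  | 0 => []
  | n + 1 => (f n.unpair.1).elim (conclusions f n) fun r =>
      bif r.1.all (fun x => decide (x ∈ conclusions f n)) then r.2 :: conclusions f n
      else conclusions f n

theorem conclusions_mono (f : ℕ → Option (List ℕ × ℕ)) {i j : ℕ} (h : i ≤ j) :
    conclusions f i ⊆ conclusions f j := by
  induction j, h using Nat.le_induction with
  | base => exact fun _ h => h
  | succ j _ ih =>
    intro x hx
    rw [conclusions]
    rcases f j.unpair.1 with _ | r
    · exact ih hx
    · simp only [Option.elim]
      cases r.1.all (fun x => decide (x ∈ conclusions f j))
      · exact ih hx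
      · exact List.mem_cons_of_mem _ (ih hx)

theorem ruleClosure_iff_exists_mem_conclusions {R : Set (List ℕ × ℕ)}
    {f : ℕ → Option (List ℕ × ℕ)} (hf : ∀ r, r ∈ R ↔ ∃ n, f n = some r) (c : ℕ) :
    RuleClosure R c ↔ ∃ n, c ∈ conclusions f n := by
  constructor
  · intro h
    induction h with
    | @intro prems c hr _ ih =>
      obtain ⟨i, hi⟩ := (hf _).1 hr
      have : ∃ k, ∀ x ∈ prems, x ∈ conclusions f k := by
        choose! k hk using ih
        refine ⟨(prems.map k).sum, fun x hx => conclusions_mono f ?_ (hk x hx)⟩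
        exact List.single_le_sum (fun _ _ => Nat.zero_le _) _ (List.mem_map_of_mem hx)
      obtain ⟨k, hk⟩ := this
      refine ⟨Nat.pair i k + 1, ?_⟩
      have hall : prems.all (fun x => decide (x ∈ conclusions f (Nat.pair i k))) = true := by
        simp only [List.all_eq_true, decide_eq_true_eq]
        exact fun x hx => conclusions_mono f (Nat.right_le_pair i k) (hk x hx)
      simp [conclusions, hi, hall]
  · rintro ⟨n, hn⟩
    induction n generalizing c with
    | zero => simp [conclusions] at hn
    | succ n ih =>
      rw [conclusions] at hn
      rcases hr : f n.unpair.1 with _ | r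
      · rw [hr] at hn
        exact ih c hn
      · rw [hr] at hn
        simp only [Option.elim] at hn
        cases hall : r.1.all (fun x => decide (x ∈ conclusions f n))
        · rw [hall] at hn
          exact ih c hn
        · rw [hall] at hn
          rcases List.mem_cons.1 hn with rfl | hn
          · refine .intro (l := r.1) ((hf _).2 ⟨_, hr⟩) fun x hx => ih x ?_
            simp only [List.all_eq_true, decide_eq_true_eq] at hall
            exact hall x hx
          · exact ih c hn

theorem primrec_listMem : Primrec₂ fun (x : ℕ) (l : List ℕ) => decide (x ∈ l) := by
  have h : Primrec₂ fun (x : ℕ) (l : List ℕ) => decide (l.idxOf x < l.length) :=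
    (Primrec.nat_lt.comp (Primrec.list_idxOf.comp Primrec.fst Primrec.snd)
      (Primrec.list_length.comp Primrec.snd)).decide
  exact h.of_eq fun x l => by simp [List.idxOf_lt_length_iff]

theorem primrec_listAllMem :
    Primrec₂ fun (l acc : List ℕ) => l.all fun x => decide (x ∈ acc) := by
  have h : Primrec fun p : List ℕ × List ℕ =>
      p.1.foldr (fun x b => decide (x ∈ p.2) && b) true :=
    Primrec.list_foldr Primrec.fst (Primrec.const true)
      (Primrec.and.comp (primrec_listMem.comp (Primrec.fst.comp Primrec.snd)
        (Primrec.snd.comp Primrec.fst)) (Primrec.snd.comp Primrec.snd)).to₂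
  refine Primrec.of_eq h fun p => ?_
  induction p.1 with
  | nil => rfl
  | cons a l ih => simp [ih]

theorem computable_conclusions {f : ℕ → Option (List ℕ × ℕ)} (hf : Computable f) :
    Computable (conclusions f) := by
  have hstep : Computable₂ fun (_ : ℕ) (p : ℕ × List ℕ) =>
      (f p.1.unpair.1).elim p.2 fun r =>
        bif r.1.all (fun x => decide (x ∈ p.2)) then r.2 :: p.2 else p.2 := by
    have hacc : Computable fun q : (ℕ × ℕ × List ℕ) × (List ℕ × ℕ) => q.1.2.2 :=
      Computable.snd.comp (Computable.snd.comp Computable.fst)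
    have := Computable.option_casesOn
      (hf.comp (Computable.fst.comp (Computable.unpair.comp (Computable.fst.comp
        (Computable.snd (α := ℕ) (β := ℕ × List ℕ))))))
      (Computable.snd.comp Computable.snd)
      (Computable.cond (primrec_listAllMem.to_comp.comp
          (Computable.fst.comp Computable.snd) hacc)
        (Computable.list_cons.comp (Computable.snd.comp Computable.snd) hacc) hacc).to₂
    refine Computable.of_eq this fun q => ?_
    dsimp only
    rcases f q.2.1.unpair.1 with _ | r <;> rfl
  refine (Computable.nat_rec Computable.id (Computable.const []) hstep).of_eq fun n => ?_
  simp only [id]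
  induction n with
  | zero => rfl
  | succ n ih =>
    simp only [ih]
    rfl

theorem rePred_ruleClosure {R : Set (List ℕ × ℕ)} (hR : RulesEnumerable R) :
    REPred (RuleClosure R) := by
  obtain ⟨f, hf, hfR⟩ := hR
  have h : Computable₂ fun c n : ℕ => decide (c ∈ conclusions f n) :=
    primrec_listMem.to_comp.comp Computable.fst
      ((computable_conclusions hf).comp Computable.snd)
  refine (Partrec.rfind h.partrec₂).dom_re.of_eq fun c => ?_
  rw [ruleClosure_iff_exists_mem_conclusions hfR]
  simp

/-! ### Horn clauses -/

/-- Terms that denote natural numbers, for use in Horn clauses: variables, constants, successors,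
affine functions and pairs. Successors are no affine functions here, so that the values of patterns
agree with Gödel numbers by definitional unfolding. -/
inductive Pat
  | var (i : ℕ)
  | const (c : ℕ)
  | succ (p : Pat)
  | affine (k c : ℕ) (p : Pat)
  | pair (p q : Pat)

/-- The value of a pattern, for given values of the variables. -/
def Pat.eval (ρ : List ℕ) : Pat → ℕ
  | .var i => ρ.getD i 0
  | .const c => c
  | .succ p => p.eval ρ + 1
  | .affine k c p => k * p.eval ρ + c
  | .pair p q => Nat.pair (p.eval ρ) (q.eval ρ)

theorem Pat.primrec_eval (p : Pat) : Primrec fun ρ => Pat.eval ρ p := by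
  induction p with
  | var i => exact (Primrec.list_getD 0).comp Primrec.id (Primrec.const i)
  | const c => exact Primrec.const c
  | succ p ih => exact Primrec.succ.comp ih
  | affine k c p ih =>
    exact Primrec.nat_add.comp (Primrec.nat_mul.comp (Primrec.const k) ih) (Primrec.const c)
  | pair p q ih₁ ih₂ => exact Primrec₂.natPair.comp ih₁ ih₂

/-- A Horn clause: a list of premises and a conclusion. -/
abbrev Clause := List Pat × Pat

/-- The rules that are instances of a clause of the program `P`. -/
def clauseRules (P : List Clause) : Set (List ℕ × ℕ) :=
  {r | ∃ c ∈ P, ∃ ρ : List ℕ, r = (c.1.map (Pat.eval ρ), c.2.eval ρ)}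

theorem rulesEnumerable_clauseRules (P : List Clause) : RulesEnumerable (clauseRules P) := by
  induction P with
  | nil =>
    convert RulesEnumerable.empty
    ext r
    simp [clauseRules]
  | cons c P ih =>
    have hprems : ∀ l : List Pat, Primrec fun ρ => l.map (Pat.eval ρ) := by
      intro l
      induction l with
      | nil => exact Primrec.const []
      | cons p l ih => exact Primrec.list_cons.comp p.primrec_eval ih
    have h : RulesEnumerable {r | ∃ ρ : List ℕ, r = (c.1.map (Pat.eval ρ), c.2.eval ρ)} := by
      refine ⟨fun n => (Encodable.decode (α := List ℕ) n).map
        fun ρ => (c.1.map (Pat.eval ρ), c.2.eval ρ), ?_, fun r => ?_⟩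
      · exact (Primrec.option_map Primrec.decode
          ((hprems c.1).pair c.2.primrec_eval |>.comp Primrec.snd).to₂).to_comp
      · constructor
        · rintro ⟨ρ, rfl⟩
          exact ⟨Encodable.encode ρ, by simp⟩
        · rintro ⟨n, hn⟩
          obtain ⟨ρ, -, hρ⟩ := Option.map_eq_some_iff.1 hn
          exact ⟨ρ, hρ.symm⟩
    convert h.union ih
    ext r
    simp [clauseRules]

/-- The values of a computable function on a type with a primitive recursive coding, as rules
without premises. -/
theorem rulesEnumerable_facts {α : Type*} [Primcodable α] {g : α → ℕ} (hg : Computable g) :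
    RulesEnumerable {r | ∃ a, r = ([], g a)} := by
  refine ⟨fun n => (Encodable.decode (α := α) n).map fun a => ([], g a), ?_, fun r => ?_⟩
  · exact Computable.option_map Computable.decode
      ((Computable.const []).pair (hg.comp Computable.snd)).to₂
  · constructor
    · rintro ⟨a, rfl⟩
      exact ⟨Encodable.encode a, by simp⟩
    · rintro ⟨n, hn⟩
      obtain ⟨a, -, ha⟩ := Option.map_eq_some_iff.1 hn
      exact ⟨a, ha.symm⟩

/-! ### The calculus as a Horn program -/

/-- The number of the judgement of kind `k` with the arguments `a`, `b`, `c`, `d`. The kinds are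
explained at `HoldsAt`; unused arguments are `0`. -/
def judg (k a : ℕ) (b c d : ℕ := 0) : ℕ := Nat.pair k (Nat.pair a (Nat.pair b (Nat.pair c d)))

namespace Pat

/-- The pattern of the judgements of kind `k`. -/
def judg (k : ℕ) (a : Pat) (b c d : Pat := .const 0) : Pat :=
  .pair (.const k) (.pair a (.pair b (.pair c d)))

theorem eval_judg (ρ : List ℕ) (k : ℕ) (a b c d : Pat) :
    (judg k a b c d).eval ρ =
      GoedelLogic.judg k (a.eval ρ) (b.eval ρ) (c.eval ρ) (d.eval ρ) := rfl

/-- The pattern of the Gödel numbers of conjunctions. -/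
def and (p q : Pat) : Pat := .affine 7 2 (.pair p q)

/-- The pattern of the Gödel numbers of disjunctions. -/
def or (p q : Pat) : Pat := .affine 7 3 (.pair p q)

/-- The pattern of the Gödel numbers of implications. -/
def imp (p q : Pat) : Pat := .affine 7 4 (.pair p q)

/-- The pattern of the Gödel numbers of universal formulas. -/
def all (p : Pat) : Pat := .affine 7 5 p

/-- The pattern of the Gödel numbers of existential formulas. -/
def ex (p : Pat) : Pat := .affine 7 6 p

/-- The pattern of the Gödel numbers of the disjunctions `bigOr`. -/
def bigOr : List Pat → Pat
  | [] => .const 0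
  | [p] => p
  | p :: q :: l => p.or (bigOr (q :: l))

/-- The pattern of the Gödel numbers of the formulas `charFormula m`. -/
def charFormula (m : ℕ) : Pat :=
  bigOr ((List.range m).map fun i =>
    bigOr ((List.range' (i + 1) (m - i)).map fun j =>
      ((var i).imp (var j)).and ((var j).imp (var i))))

/-- The clauses that compute substitutions in variables, terms, lists of terms and formulas.
The substitution with number `0` is the one of `Formula.lift`, the numbers `3 * t + 1` belong to
`instSubst`, and `3 * s + 2` to `upSubst`. -/
def substClauses : List Clause :=
  [
   -- Values of substitutions at variables. The premise of the first clause ensures that its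
   -- variable `0` is the Gödel number of a term.
   ([judg 3 (const 0) (var 0) (var 1)], judg 2 (affine 3 1 (var 0)) (const 0) (var 0)),
   ([], judg 2 (affine 3 1 (var 0)) (succ (var 1)) (affine 2 0 (var 1))),
   ([], judg 2 (const 0) (var 0) (affine 2 0 (succ (var 0)))),
   ([], judg 2 (affine 3 2 (var 0)) (const 0) (const 0)),
   ([judg 2 (var 0) (var 1) (var 2), judg 3 (const 0) (var 2) (var 3)],
    judg 2 (affine 3 2 (var 0)) (succ (var 1)) (var 3)),
   -- Terms and lists of terms.
   ([judg 2 (var 0) (var 1) (var 2)], judg 3 (var 0) (affine 2 0 (var 1)) (var 2)),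
   ([judg 0 (var 1) (var 2), judg 4 (var 0) (var 2) (var 3) (var 4)],
    judg 3 (var 0) (affine 2 1 (pair (var 1) (var 3))) (affine 2 1 (pair (var 1) (var 4)))),
   ([], judg 4 (var 0)),
   ([judg 3 (var 0) (var 1) (var 2), judg 4 (var 0) (var 3) (var 4) (var 5)],
    judg 4 (var 0) (succ (var 3)) (succ (pair (var 1) (var 4))) (succ (pair (var 2) (var 5)))),
   -- Formulas.
   ([], judg 5 (var 0)),
   ([judg 1 (var 1) (var 2), judg 4 (var 0) (var 2) (var 3) (var 4)],
    judg 5 (var 0) (affine 7 1 (pair (var 1) (var 3))) (affine 7 1 (pair (var 1) (var 4)))),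
   ([judg 5 (var 0) (var 1) (var 2), judg 5 (var 0) (var 3) (var 4)],
    judg 5 (var 0) ((var 1).and (var 3)) ((var 2).and (var 4))),
   ([judg 5 (var 0) (var 1) (var 2), judg 5 (var 0) (var 3) (var 4)],
    judg 5 (var 0) ((var 1).or (var 3)) ((var 2).or (var 4))),
   ([judg 5 (var 0) (var 1) (var 2), judg 5 (var 0) (var 3) (var 4)],
    judg 5 (var 0) ((var 1).imp (var 3)) ((var 2).imp (var 4))),
   ([judg 5 (affine 3 2 (var 0)) (var 1) (var 2)], judg 5 (var 0) (var 1).all (var 2).all),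
   ([judg 5 (affine 3 2 (var 0)) (var 1) (var 2)], judg 5 (var 0) (var 1).ex (var 2).ex)]

/-- The clause for an axiom schema in `n` formulas. The premises, about the result of lifting,
ensure that the values of the first `n` variables are Gödel numbers of formulas. -/
def axiomClause (n : ℕ) (p : Pat) : Clause :=
  ((List.range n).map fun i => judg 5 (const 0) (var i) (var (n + i)), judg 6 p)

/-- The clauses for the axioms of propositional Gödel logic. -/
def axiomClauses : List Clause :=
  [axiomClause 2 ((var 0).imp ((var 1).imp (var 0))),
   axiomClause 3 (((var 0).imp ((var 1).imp (var 2))).imp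
    (((var 0).imp (var 1)).imp ((var 0).imp (var 2)))),
   axiomClause 2 (((var 0).and (var 1)).imp (var 0)),
   axiomClause 2 (((var 0).and (var 1)).imp (var 1)),
   axiomClause 2 ((var 0).imp ((var 1).imp ((var 0).and (var 1)))),
   axiomClause 2 ((var 0).imp ((var 0).or (var 1))),
   axiomClause 2 ((var 1).imp ((var 0).or (var 1))),
   axiomClause 3 (((var 0).imp (var 2)).imp (((var 1).imp (var 2)).imp
    (((var 0).or (var 1)).imp (var 2)))),
   axiomClause 1 ((const 0).imp (var 0)),
   axiomClause 2 (((var 0).imp (var 1)).or ((var 1).imp (var 0)))]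

/-- The clauses for modus ponens and the quantifier rules. -/
def ruleClauses : List Clause :=
  [([judg 6 ((var 0).imp (var 1)), judg 6 (var 0)], judg 6 (var 1)),
   ([judg 6 (var 0)], judg 6 (var 0).all),
   ([judg 5 (affine 3 1 (var 0)) (var 1) (var 2), judg 6 (var 2)], judg 6 (var 1).ex),
   ([judg 5 (const 0) (var 1) (var 2), judg 6 ((var 0).or (var 2)).all],
    judg 6 ((var 0).all.or (var 1))),
   ([judg 5 (const 0) (var 1) (var 2), judg 6 ((var 0).or (var 2)).ex],
    judg 6 ((var 0).ex.or (var 1)))]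

/-- The clauses for quantifier-free, prenex, and derivable prenex formulas. -/
def prenexClauses : List Clause :=
  [([], judg 7 (const 0)),
   ([], judg 7 (affine 7 1 (pair (var 0) (var 1)))),
   ([judg 7 (var 0), judg 7 (var 1)], judg 7 ((var 0).and (var 1))),
   ([judg 7 (var 0), judg 7 (var 1)], judg 7 ((var 0).or (var 1))),
   ([judg 7 (var 0), judg 7 (var 1)], judg 7 ((var 0).imp (var 1))),
   ([judg 7 (var 0)], judg 8 (var 0)),
   ([judg 8 (var 0)], judg 8 (var 0).all),
   ([judg 8 (var 0)], judg 8 (var 0).ex),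
   ([judg 8 (var 0), judg 6 (var 0)], judg 9 (var 0))]

/-- The clauses for the calculus with the additional axioms that the clauses in `E` yield. -/
def program (E : List Clause) : List Clause :=
  substClauses ++ axiomClauses ++ ruleClauses ++ prenexClauses ++ E

end Pat

section Coding

variable [Encodable (Σ n, L.Functions n)]

/-- The term with Gödel number `c`; the variable `0` if there is none. -/
noncomputable def termOf (c : ℕ) : L.Term ℕ :=
  open Classical in if h : ∃ t : L.Term ℕ, termCode t = c then h.choose else .var 0

theorem termOf_code (t : L.Term ℕ) : termOf (termCode t) = t := by
  have h : ∃ t' : L.Term ℕ, termCode t' = termCode t := ⟨t, rfl⟩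
  rw [termOf, dif_pos h]
  exact termCode_injective h.choose_spec

/-- The substitution with number `c`. -/
noncomputable def substOf (c : ℕ) : ℕ → L.Term ℕ :=
  if h : c = 0 then fun k => .var (k + 1)
  else if c % 3 = 1 then instSubst (termOf (c / 3)) else upSubst (substOf (c / 3))
termination_by c
decreasing_by omega

theorem substOf_zero : substOf (L := L) 0 = fun k => .var (k + 1) := by
  rw [substOf, dif_pos rfl]

theorem substOf_inst (c : ℕ) : substOf (L := L) (3 * c + 1) = instSubst (termOf c) := by
  rw [substOf, dif_neg (by omega), if_pos (by omega), show (3 * c + 1) / 3 = c by omega]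

theorem substOf_up (c : ℕ) : substOf (L := L) (3 * c + 2) = upSubst (substOf c) := by
  rw [substOf, dif_neg (by omega), if_neg (by omega), show (3 * c + 2) / 3 = c by omega]

theorem subst_substOf_zero (φ : Formula L) : φ.subst (substOf 0) = φ.lift := by
  rw [substOf_zero, Formula.lift]

theorem upSubst_substOf_succ (s k : ℕ) :
    upSubst (substOf s) (k + 1) = (substOf (L := L) s k).subst (substOf 0) := by
  rw [substOf_zero, upSubst, term_relabel_eq_subst]

/-- The Gödel number of a list of terms. -/
def termsCode {n : ℕ} (ts : Fin n → L.Term ℕ) : ℕ :=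
  Encodable.encode (List.ofFn fun i => termCode (ts i))

theorem termsCode_zero (ts : Fin 0 → L.Term ℕ) : termsCode ts = 0 := by
  simp [termsCode]

theorem termsCode_succ {n : ℕ} (ts : Fin (n + 1) → L.Term ℕ) :
    termsCode ts = Nat.pair (termCode (ts 0)) (termsCode fun i => ts i.succ) + 1 := by
  simp [termsCode, List.ofFn_succ]

variable [Encodable (Σ n, L.Relations n)]

/-- The intended meaning of the judgement of kind `k` with the arguments `a`, `b`, `c`, `d`, over
the axioms `T`. Kinds `0` and `1`: symbols and their arities; `2` to `5`: the results of
substitutions in variables, terms, lists of terms and formulas; `6`: derivable formulas; `7` and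
`8`: quantifier-free and prenex formulas (numbers that code no formula count as such); `9`:
derivable prenex formulas. -/
def HoldsAt (T : Set (Formula L)) (k a b c d : ℕ) : Prop :=
  match k with
  | 0 => ∃ F : Σ n, L.Functions n, Encodable.encode F = a ∧ F.1 = b
  | 1 => ∃ R : Σ n, L.Relations n, Encodable.encode R = a ∧ R.1 = b
  | 2 => c = termCode (substOf (L := L) a b)
  | 3 => ∃ t : L.Term ℕ, b = termCode t ∧ c = termCode (t.subst (substOf a))
  | 4 => ∃ ts : Fin b → L.Term ℕ, c = termsCode ts ∧
      d = termsCode fun i => (ts i).subst (substOf a)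
  | 5 => ∃ A : Formula L, b = A.code ∧ c = (A.subst (substOf a)).code
  | 6 => ∃ A : Formula L, a = A.code ∧ GenDerivable T A
  | 7 => ∀ A : Formula L, a = A.code → A.QuantifierFree
  | 8 => ∀ A : Formula L, a = A.code → A.IsPrenex
  | _ => ∃ A : Formula L, a = A.code ∧ A.IsPrenex ∧ GenDerivable T A

/-- The intended meaning of the judgement with number `x`. -/
def Holds (T : Set (Formula L)) (x : ℕ) : Prop :=
  HoldsAt T x.unpair.1 x.unpair.2.unpair.1 x.unpair.2.unpair.2.unpair.1
    x.unpair.2.unpair.2.unpair.2.unpair.1 x.unpair.2.unpair.2.unpair.2.unpair.2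

theorem holds_judg (T : Set (Formula L)) (k a b c d : ℕ) :
    Holds T (judg k a b c d) ↔ HoldsAt T k a b c d := by
  simp only [Holds, judg, Nat.unpair_pair]

-- Otherwise unification tries to evaluate the pairing functions.
attribute [irreducible] Holds

/-- Every instance of the clause preserves the intended meaning. -/
def ClauseSound (T : Set (Formula L)) (c : Clause) : Prop :=
  ∀ ρ : List ℕ, (∀ p ∈ c.1, Holds T (p.eval ρ)) → Holds T (c.2.eval ρ)

theorem code_eq_imp {A : Formula L} {a b : ℕ} (h : 7 * Nat.pair a b + 4 = A.code) :
    ∃ B C : Formula L, A = .imp B C ∧ a = B.code ∧ b = C.code := by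
  cases A with
  | imp B C =>
    simp only [Formula.code, Nat.add_right_cancel_iff,
      Nat.mul_left_cancel_iff (show 0 < 7 by norm_num), Nat.pair_eq_pair] at h
    exact ⟨B, C, rfl, h⟩
  | _ => simp only [Formula.code] at h; omega

theorem code_eq_and {A : Formula L} {a b : ℕ} (h : 7 * Nat.pair a b + 2 = A.code) :
    ∃ B C : Formula L, A = .and B C ∧ a = B.code ∧ b = C.code := by
  cases A with
  | and B C =>
    simp only [Formula.code, Nat.add_right_cancel_iff,
      Nat.mul_left_cancel_iff (show 0 < 7 by norm_num), Nat.pair_eq_pair] at h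
    exact ⟨B, C, rfl, h⟩
  | _ => simp only [Formula.code] at h; omega

theorem code_eq_or {A : Formula L} {a b : ℕ} (h : 7 * Nat.pair a b + 3 = A.code) :
    ∃ B C : Formula L, A = .or B C ∧ a = B.code ∧ b = C.code := by
  cases A with
  | or B C =>
    simp only [Formula.code, Nat.add_right_cancel_iff,
      Nat.mul_left_cancel_iff (show 0 < 7 by norm_num), Nat.pair_eq_pair] at h
    exact ⟨B, C, rfl, h⟩
  | _ => simp only [Formula.code] at h; omega

theorem code_eq_all {A : Formula L} {a : ℕ} (h : 7 * a + 5 = A.code) :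
    ∃ B : Formula L, A = .all B ∧ a = B.code := by
  cases A with
  | all B =>
    simp only [Formula.code] at h
    exact ⟨B, rfl, by omega⟩
  | _ => simp only [Formula.code] at h; omega

theorem code_eq_ex {A : Formula L} {a : ℕ} (h : 7 * a + 6 = A.code) :
    ∃ B : Formula L, A = .ex B ∧ a = B.code := by
  cases A with
  | ex B =>
    simp only [Formula.code] at h
    exact ⟨B, rfl, by omega⟩
  | _ => simp only [Formula.code] at h; omega

theorem substClauses_sound (T : Set (Formula L)) : ∀ c ∈ Pat.substClauses, ClauseSound T c := by
  simp only [Pat.substClauses, List.forall_mem_cons, ClauseSound, Pat.eval_judg, holds_judg,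
    Pat.and, Pat.or, Pat.imp, Pat.all, Pat.ex, Pat.eval]
  refine ⟨?_, ?_, ?_, ?_, ?_, ?_, ?_, ?_, ?_, ?_, ?_, ?_, ?_, ?_, ?_, ?_, by simp⟩
  all_goals intro ρ h
  all_goals simp only [List.not_mem_nil, false_implies, implies_true, and_true] at h
  · obtain ⟨t, ht, -⟩ := h
    change _ = _
    rw [substOf_inst, ht, termOf_code]
    rfl
  · change _ = _
    rw [substOf_inst]
    rfl
  · change _ = _
    rw [substOf_zero]
    rfl
  · change _ = _
    rw [substOf_up]
    rfl
  · have h₁ := h.1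
    obtain ⟨t, ht, ht'⟩ := h.2
    change _ = _
    rw [substOf_up, upSubst_substOf_succ, termCode_injective (h₁.symm.trans ht), ht']
  · exact ⟨.var _, rfl, h⟩
  · obtain ⟨F, hF, hF'⟩ := h.1
    obtain ⟨ts, hts, hts'⟩ := h.2
    revert ts
    rw [← hF', ← hF]
    intro ts hts hts'
    refine ⟨.func F.2 ts, ?_, ?_⟩
    · rw [hts]
      rfl
    · rw [hts']
      rfl
  · refine ⟨fun i => i.elim0, ?_, ?_⟩ <;> exact (termsCode_zero _).symm
  · obtain ⟨t, ht, ht'⟩ := h.1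
    obtain ⟨ts, hts, hts'⟩ := h.2
    refine ⟨Fin.cons t ts, ?_, ?_⟩
    · rw [termsCode_succ, ht, hts]
      rfl
    · rw [termsCode_succ, ht', hts']
      rfl
  · exact ⟨.bot, rfl, rfl⟩
  · obtain ⟨R, hR, hR'⟩ := h.1
    obtain ⟨ts, hts, hts'⟩ := h.2
    revert ts
    rw [← hR', ← hR]
    intro ts hts hts'
    refine ⟨.rel R.2 ts, ?_, ?_⟩
    · rw [hts]
      rfl
    · rw [hts']
      rfl
  · obtain ⟨A, hA, hA'⟩ := h.1
    obtain ⟨B, hB, hB'⟩ := h.2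
    refine ⟨.and A B, ?_, ?_⟩
    · rw [hA, hB, Formula.code]
    · rw [hA', hB', Formula.subst, Formula.code]
  · obtain ⟨A, hA, hA'⟩ := h.1
    obtain ⟨B, hB, hB'⟩ := h.2
    refine ⟨.or A B, ?_, ?_⟩
    · rw [hA, hB, Formula.code]
    · rw [hA', hB', Formula.subst, Formula.code]
  · obtain ⟨A, hA, hA'⟩ := h.1
    obtain ⟨B, hB, hB'⟩ := h.2
    refine ⟨.imp A B, ?_, ?_⟩
    · rw [hA, hB, Formula.code]
    · rw [hA', hB', Formula.subst, Formula.code]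
  · obtain ⟨A, hA, hA'⟩ := h
    refine ⟨.all A, ?_, ?_⟩
    · rw [hA, Formula.code]
    · rw [hA', substOf_up, Formula.subst, Formula.code]
  · obtain ⟨A, hA, hA'⟩ := h
    refine ⟨.ex A, ?_, ?_⟩
    · rw [hA, Formula.code]
    · rw [hA', substOf_up, Formula.subst, Formula.code]

theorem axiomClause_sound {T : Set (Formula L)} {n : ℕ} {p : Pat}
    (h : ∀ (ρ : List ℕ) (A : ℕ → Formula L), (∀ i < n, ρ.getD i 0 = (A i).code) →
      ∃ B : Formula L, p.eval ρ = B.code ∧ GenDerivable T B) :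
    ClauseSound T (Pat.axiomClause n p) := by
  intro ρ hρ
  simp only [Pat.axiomClause, List.mem_map, List.mem_range, forall_exists_index, and_imp,
    forall_apply_eq_imp_iff₂, Pat.eval_judg, holds_judg, Pat.eval] at hρ
  have : Nonempty (Formula L) := ⟨.bot⟩
  choose! A hA _ using hρ
  exact (holds_judg T _ _ _ _ _).2 (h ρ A hA)

theorem axiomClauses_sound (T : Set (Formula L)) : ∀ c ∈ Pat.axiomClauses, ClauseSound T c := by
  simp only [Pat.axiomClauses, List.forall_mem_cons]
  refine ⟨?_, ?_, ?_, ?_, ?_, ?_, ?_, ?_, ?_, ?_, List.forall_mem_nil _⟩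
  · refine axiomClause_sound fun ρ A hA => ⟨_, ?_, .imp_k (A 0) (A 1)⟩
    simp only [Pat.eval, Pat.imp, Formula.code,
      hA 0 (by omega), hA 1 (by omega)]
  · refine axiomClause_sound fun ρ A hA => ⟨_, ?_, .imp_s (A 0) (A 1) (A 2)⟩
    simp only [Pat.eval, Pat.imp, Formula.code,
      hA 0 (by omega), hA 1 (by omega), hA 2 (by omega)]
  · refine axiomClause_sound fun ρ A hA => ⟨_, ?_, .and_left (A 0) (A 1)⟩
    simp only [Pat.eval, Pat.and, Pat.imp, Formula.code,
      hA 0 (by omega), hA 1 (by omega)]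
  · refine axiomClause_sound fun ρ A hA => ⟨_, ?_, .and_right (A 0) (A 1)⟩
    simp only [Pat.eval, Pat.and, Pat.imp, Formula.code,
      hA 0 (by omega), hA 1 (by omega)]
  · refine axiomClause_sound fun ρ A hA => ⟨_, ?_, .and_intro (A 0) (A 1)⟩
    simp only [Pat.eval, Pat.and, Pat.imp, Formula.code,
      hA 0 (by omega), hA 1 (by omega)]
  · refine axiomClause_sound fun ρ A hA => ⟨_, ?_, .or_left (A 0) (A 1)⟩
    simp only [Pat.eval, Pat.or, Pat.imp, Formula.code,
      hA 0 (by omega), hA 1 (by omega)]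
  · refine axiomClause_sound fun ρ A hA => ⟨_, ?_, .or_right (A 0) (A 1)⟩
    simp only [Pat.eval, Pat.or, Pat.imp, Formula.code,
      hA 0 (by omega), hA 1 (by omega)]
  · refine axiomClause_sound fun ρ A hA => ⟨_, ?_, .or_elim (A 0) (A 1) (A 2)⟩
    simp only [Pat.eval, Pat.or, Pat.imp, Formula.code,
      hA 0 (by omega), hA 1 (by omega), hA 2 (by omega)]
  · refine axiomClause_sound fun ρ A hA => ⟨_, ?_, .bot_elim (A 0)⟩
    simp only [Pat.eval, Pat.imp, Formula.code,
      hA 0 (by omega)]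
  · refine axiomClause_sound fun ρ A hA => ⟨_, ?_, .linear (A 0) (A 1)⟩
    simp only [Pat.eval, Pat.or, Pat.imp, Formula.code,
      hA 0 (by omega), hA 1 (by omega)]

theorem ruleClauses_sound (T : Set (Formula L)) : ∀ c ∈ Pat.ruleClauses, ClauseSound T c := by
  simp only [Pat.ruleClauses, List.forall_mem_cons, ClauseSound, Pat.eval_judg, holds_judg,
    Pat.or, Pat.imp, Pat.all, Pat.ex, Pat.eval]
  refine ⟨?_, ?_, ?_, ?_, ?_, by simp⟩
  all_goals intro ρ h
  all_goals simp only [List.not_mem_nil, false_implies, implies_true, and_true] at h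
  · obtain ⟨A, hA, hder⟩ := h.1
    obtain ⟨B, hB, hder'⟩ := h.2
    obtain ⟨B', C, rfl, hB', hC⟩ := code_eq_imp hA
    rw [Formula.code_injective (hB'.symm.trans hB)] at hder
    exact ⟨C, hC, hder.mp hder'⟩
  · obtain ⟨A, hA, hder⟩ := h
    exact ⟨.all A, by rw [hA, Formula.code], hder.all_intro⟩
  · obtain ⟨A, hA, hA'⟩ := h.1
    obtain ⟨B, hB, hder⟩ := h.2
    rw [← Formula.code_injective (hA'.symm.trans hB), substOf_inst] at hder
    exact ⟨.ex A, by rw [hA, Formula.code], .ex_intro _ hder⟩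
  · obtain ⟨B, hB, hB'⟩ := h.1
    obtain ⟨C, hC, hder⟩ := h.2
    obtain ⟨D, rfl, hD⟩ := code_eq_all hC
    obtain ⟨A, B', rfl, hA, hB''⟩ := code_eq_or hD
    rw [← Formula.code_injective (hB'.symm.trans hB''), subst_substOf_zero] at hder
    exact ⟨.or (.all A) B, by rw [hA, hB, Formula.code, Formula.code], hder.all_or⟩
  · obtain ⟨B, hB, hB'⟩ := h.1
    obtain ⟨C, hC, hder⟩ := h.2
    obtain ⟨D, rfl, hD⟩ := code_eq_ex hC
    obtain ⟨A, B', rfl, hA, hB''⟩ := code_eq_or hD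
    rw [← Formula.code_injective (hB'.symm.trans hB''), subst_substOf_zero] at hder
    exact ⟨.or (.ex A) B, by rw [hA, hB, Formula.code, Formula.code], hder.ex_or⟩

theorem prenexClauses_sound (T : Set (Formula L)) :
    ∀ c ∈ Pat.prenexClauses, ClauseSound T c := by
  simp only [Pat.prenexClauses, List.forall_mem_cons, ClauseSound, Pat.eval_judg, holds_judg,
    Pat.and, Pat.or, Pat.imp, Pat.all, Pat.ex, Pat.eval]
  refine ⟨?_, ?_, ?_, ?_, ?_, ?_, ?_, ?_, ?_, by simp⟩
  all_goals intro ρ h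
  all_goals simp only [List.not_mem_nil, false_implies, implies_true, and_true] at h
  · intro A hA
    cases A <;> simp only [Formula.code] at hA <;> first | omega | trivial
  · intro A hA
    cases A <;> simp only [Formula.code] at hA <;> first | omega | trivial
  · intro A hA
    obtain ⟨B, C, rfl, hB, hC⟩ := code_eq_and hA
    exact ⟨h.1 B hB, h.2 C hC⟩
  · intro A hA
    obtain ⟨B, C, rfl, hB, hC⟩ := code_eq_or hA
    exact ⟨h.1 B hB, h.2 C hC⟩
  · intro A hA
    obtain ⟨B, C, rfl, hB, hC⟩ := code_eq_imp hA
    exact ⟨h.1 B hB, h.2 C hC⟩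
  · exact fun A hA => .of_quantifierFree (h A hA)
  · intro A hA
    obtain ⟨B, rfl, hB⟩ := code_eq_all hA
    exact .all (h B hB)
  · intro A hA
    obtain ⟨B, rfl, hB⟩ := code_eq_ex hA
    exact .ex (h B hB)
  · obtain ⟨A, hA, hder⟩ := h.2
    exact ⟨A, hA, h.1 A hA, hder⟩

/-- The rules of the program, with the arities of the symbols of `L` as facts. -/
def rules (L : FirstOrder.Language.{u, v}) [Encodable (Σ n, L.Functions n)]
    [Encodable (Σ n, L.Relations n)] (E : List Clause) : Set (List ℕ × ℕ) :=
  {r | ∃ F : Σ n, L.Functions n, r = ([], judg 0 (Encodable.encode F) F.1)} ∪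
    {r | ∃ R : Σ n, L.Relations n, r = ([], judg 1 (Encodable.encode R) R.1)} ∪
    clauseRules (Pat.program E)

theorem RuleClosure.holds {T : Set (Formula L)} {E : List Clause}
    (hE : ∀ c ∈ E, ClauseSound T c) {x : ℕ} (h : RuleClosure (rules L E) x) : Holds T x := by
  induction h with
  | @intro l c hr _ ih =>
    rcases hr with (⟨F, hF⟩ | ⟨R, hR⟩) | ⟨cl, hcl, ρ, hρ⟩
    · cases hF
      exact (holds_judg T _ _ _ _ _).2 ⟨F, rfl, rfl⟩
    · cases hR
      exact (holds_judg T _ _ _ _ _).2 ⟨R, rfl, rfl⟩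
    · cases hρ
      have hsound : ClauseSound T cl := by
        simp only [Pat.program, List.mem_append] at hcl
        rcases hcl with (((hcl | hcl) | hcl) | hcl) | hcl
        · exact substClauses_sound T cl hcl
        · exact axiomClauses_sound T cl hcl
        · exact ruleClauses_sound T cl hcl
        · exact prenexClauses_sound T cl hcl
        · exact hE cl hcl
      exact hsound ρ fun p hp => ih _ (List.mem_map_of_mem hp)

section Completeness

variable {E : List Clause}

theorem ruleClosure_of_mem {c : Clause} (hc : c ∈ Pat.program E) (ρ : List ℕ)
    (h : c.1.Forall fun p => RuleClosure (rules L E) (p.eval ρ)) :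
    RuleClosure (rules L E) (c.2.eval ρ) := by
  refine .intro (Or.inr ⟨c, hc, ρ, rfl⟩) fun x hx => ?_
  obtain ⟨p, hp, rfl⟩ := List.mem_map.1 hx
  exact List.forall_iff_forall_mem.1 h p hp

theorem ruleClosure_subst (i : ℕ) (ρ : List ℕ)
    (hi : i < Pat.substClauses.length := by decide)
    (h : Pat.substClauses[i].1.Forall fun p => RuleClosure (rules L E) (p.eval ρ)) :
    RuleClosure (rules L E) (Pat.substClauses[i].2.eval ρ) :=
  ruleClosure_of_mem (by simp [Pat.program]) ρ h

theorem ruleClosure_rule (i : ℕ) (ρ : List ℕ)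
    (hi : i < Pat.ruleClauses.length := by decide)
    (h : Pat.ruleClauses[i].1.Forall fun p => RuleClosure (rules L E) (p.eval ρ)) :
    RuleClosure (rules L E) (Pat.ruleClauses[i].2.eval ρ) :=
  ruleClosure_of_mem (by simp [Pat.program]) ρ h

theorem ruleClosure_prenex (i : ℕ) (ρ : List ℕ)
    (hi : i < Pat.prenexClauses.length := by decide)
    (h : Pat.prenexClauses[i].1.Forall fun p => RuleClosure (rules L E) (p.eval ρ)) :
    RuleClosure (rules L E) (Pat.prenexClauses[i].2.eval ρ) :=
  ruleClosure_of_mem (by simp [Pat.program]) ρ h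

/-- The program computes the values of the substitution with number `s`. -/
def ComputesSubst (L : FirstOrder.Language.{u, v}) [Encodable (Σ n, L.Functions n)]
    [Encodable (Σ n, L.Relations n)] (E : List Clause) (s : ℕ) : Prop :=
  ∀ k, RuleClosure (rules L E) (judg 2 s k (termCode (substOf (L := L) s k)))

theorem computesSubst_lift : ComputesSubst L E 0 := by
  intro k
  rw [substOf_zero]
  exact ruleClosure_subst 2 [k] (h := trivial)

theorem ruleClosure_terms (s : ℕ) {n : ℕ} (ts : Fin n → L.Term ℕ)
    (h : ∀ i, RuleClosure (rules L E)
      (judg 3 s (termCode (ts i)) (termCode ((ts i).subst (substOf s))))) :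
    RuleClosure (rules L E)
      (judg 4 s n (termsCode ts) (termsCode fun i => (ts i).subst (substOf s))) := by
  induction n with
  | zero =>
    rw [termsCode_zero, termsCode_zero]
    exact ruleClosure_subst 7 [s] (h := trivial)
  | succ n ih =>
    rw [termsCode_succ, termsCode_succ]
    exact ruleClosure_subst 8 [s, _, _, n, _, _] (h := ⟨h 0, ih _ fun i => h i.succ⟩)

theorem ruleClosure_term {s : ℕ} (hs : ComputesSubst L E s) (t : L.Term ℕ) :
    RuleClosure (rules L E) (judg 3 s (termCode t) (termCode (t.subst (substOf s)))) := by
  induction t with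
  | var k => exact ruleClosure_subst 5 [s, k, _] (h := hs k)
  | @func n f ts ih =>
    exact ruleClosure_subst 6 [s, Encodable.encode (⟨n, f⟩ : Σ n, L.Functions n), n,
      termsCode ts, termsCode fun i => (ts i).subst (substOf s)]
      (h := ⟨.intro (Or.inl (Or.inl ⟨⟨n, f⟩, rfl⟩)) (by simp), ruleClosure_terms s ts ih⟩)

theorem computesSubst_inst (t : L.Term ℕ) : ComputesSubst L E (3 * termCode t + 1) := by
  intro k
  rw [substOf_inst, termOf_code]
  cases k with
  | zero => exact ruleClosure_subst 0 [termCode t, _] (h := ruleClosure_term computesSubst_lift t)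
  | succ k => exact ruleClosure_subst 1 [termCode t, k] (h := trivial)

theorem ComputesSubst.up {s : ℕ} (hs : ComputesSubst L E s) : ComputesSubst L E (3 * s + 2) := by
  intro k
  rw [substOf_up]
  cases k with
  | zero => exact ruleClosure_subst 3 [s] (h := trivial)
  | succ k =>
    rw [upSubst_substOf_succ]
    exact ruleClosure_subst 4 [s, k, _, _] (h := ⟨hs k, ruleClosure_term computesSubst_lift _⟩)

theorem ruleClosure_formula {s : ℕ} (hs : ComputesSubst L E s) (A : Formula L) :
    RuleClosure (rules L E) (judg 5 s A.code (A.subst (substOf s)).code) := by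
  induction A generalizing s with
  | bot => exact ruleClosure_subst 9 [s] (h := trivial)
  | @rel n R ts =>
    exact ruleClosure_subst 10 [s, Encodable.encode (⟨n, R⟩ : Σ n, L.Relations n), n,
      termsCode ts, termsCode fun i => (ts i).subst (substOf s)]
      (h := ⟨.intro (Or.inl (Or.inr ⟨⟨n, R⟩, rfl⟩)) (by simp),
        ruleClosure_terms s ts fun i => ruleClosure_term hs (ts i)⟩)
  | and A B ih₁ ih₂ =>
    exact ruleClosure_subst 11 [s, A.code, _, B.code, _] (h := ⟨ih₁ hs, ih₂ hs⟩)
  | or A B ih₁ ih₂ =>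
    exact ruleClosure_subst 12 [s, A.code, _, B.code, _] (h := ⟨ih₁ hs, ih₂ hs⟩)
  | imp A B ih₁ ih₂ =>
    exact ruleClosure_subst 13 [s, A.code, _, B.code, _] (h := ⟨ih₁ hs, ih₂ hs⟩)
  | all A ih =>
    have h := ih hs.up
    rw [substOf_up] at h
    exact ruleClosure_subst 14 [s, A.code, _] (h := h)
  | ex A ih =>
    have h := ih hs.up
    rw [substOf_up] at h
    exact ruleClosure_subst 15 [s, A.code, _] (h := h)

theorem ruleClosure_lift (A : Formula L) :
    RuleClosure (rules L E) (judg 5 0 A.code A.lift.code) := by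
  have h := ruleClosure_formula (E := E) computesSubst_lift A
  rwa [subst_substOf_zero] at h

theorem ruleClosure_axiomClause (l : List (Formula L)) {p : Pat}
    (hp : Pat.axiomClause l.length p ∈ Pat.program E) :
    RuleClosure (rules L E)
      (judg 6 (p.eval (l.map Formula.code ++ l.map fun A => A.lift.code))) := by
  refine ruleClosure_of_mem hp (l.map Formula.code ++ l.map fun A => A.lift.code) ?_
  rw [List.forall_iff_forall_mem]
  intro q hq
  obtain ⟨i, hi, rfl⟩ := List.mem_map.1 hq
  rw [List.mem_range] at hi
  rw [Pat.eval_judg]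
  convert ruleClosure_lift (E := E) l[i] using 2 <;>
    simp [Pat.eval, List.getD_eq_getElem?_getD, List.getElem?_append, hi]

theorem ruleClosure_axiom (l : List (Formula L)) (i : ℕ) (p : Pat)
    (hp : Pat.axiomClauses[i]? = some (Pat.axiomClause l.length p)) :
    RuleClosure (rules L E)
      (judg 6 (p.eval (l.map Formula.code ++ l.map fun A => A.lift.code))) :=
  ruleClosure_axiomClause l (by simp [Pat.program, List.mem_of_getElem? hp])

theorem GenDerivable.ruleClosure {T : Set (Formula L)}
    (hE : ∀ A ∈ T, RuleClosure (rules L E) (judg 6 A.code)) {A : Formula L}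
    (h : GenDerivable T A) : RuleClosure (rules L E) (judg 6 A.code) := by
  induction h with
  | ax h => exact hE _ h
  | imp_k A B => exact ruleClosure_axiom [A, B] 0 _ rfl
  | imp_s A B C => exact ruleClosure_axiom [A, B, C] 1 _ rfl
  | and_left A B => exact ruleClosure_axiom [A, B] 2 _ rfl
  | and_right A B => exact ruleClosure_axiom [A, B] 3 _ rfl
  | and_intro A B => exact ruleClosure_axiom [A, B] 4 _ rfl
  | or_left A B => exact ruleClosure_axiom [A, B] 5 _ rfl
  | or_right A B => exact ruleClosure_axiom [A, B] 6 _ rfl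
  | or_elim A B C => exact ruleClosure_axiom [A, B, C] 7 _ rfl
  | bot_elim A => exact ruleClosure_axiom [A] 8 _ rfl
  | linear A B => exact ruleClosure_axiom [A, B] 9 _ rfl
  | @mp A B _ _ ih₁ ih₂ => exact ruleClosure_rule 0 [A.code, B.code] (h := ⟨ih₁, ih₂⟩)
  | @all_intro A _ ih => exact ruleClosure_rule 1 [A.code] (h := ih)
  | @ex_intro A t _ ih =>
    have h := ruleClosure_formula (E := E) (computesSubst_inst t) A
    rw [substOf_inst, termOf_code] at h
    exact ruleClosure_rule 2 [termCode t, A.code, _] (h := ⟨h, ih⟩)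
  | @all_or A B _ ih =>
    exact ruleClosure_rule 3 [A.code, B.code, B.lift.code] (h := ⟨ruleClosure_lift B, ih⟩)
  | @ex_or A B _ ih =>
    exact ruleClosure_rule 4 [A.code, B.code, B.lift.code] (h := ⟨ruleClosure_lift B, ih⟩)

theorem Formula.QuantifierFree.ruleClosure {A : Formula L} (h : A.QuantifierFree) :
    RuleClosure (rules L E) (judg 7 A.code) := by
  induction A with
  | bot => exact ruleClosure_prenex 0 [] (h := trivial)
  | @rel n R ts =>
    exact ruleClosure_prenex 1
      [Encodable.encode (⟨n, R⟩ : Σ n, L.Relations n), termsCode ts] (h := trivial)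
  | and A B ih₁ ih₂ =>
    exact ruleClosure_prenex 2 [A.code, B.code] (h := ⟨ih₁ h.1, ih₂ h.2⟩)
  | or A B ih₁ ih₂ =>
    exact ruleClosure_prenex 3 [A.code, B.code] (h := ⟨ih₁ h.1, ih₂ h.2⟩)
  | imp A B ih₁ ih₂ =>
    exact ruleClosure_prenex 4 [A.code, B.code] (h := ⟨ih₁ h.1, ih₂ h.2⟩)
  | all | ex => exact h.elim

theorem Formula.IsPrenex.ruleClosure {A : Formula L} (h : A.IsPrenex) :
    RuleClosure (rules L E) (judg 8 A.code) := by
  induction h with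
  | @of_quantifierFree A h => exact ruleClosure_prenex 5 [A.code] (h := h.ruleClosure)
  | @all A _ ih => exact ruleClosure_prenex 6 [A.code] (h := ih)
  | @ex A _ ih => exact ruleClosure_prenex 7 [A.code] (h := ih)

end Completeness

/-- The program enumerates the derivable prenex formulas as soon as the clauses in `E` yield
derivable formulas only, among them the additional axioms. -/
theorem ruleClosure_iff {T : Set (Formula L)} {E : List Clause}
    (hsound : ∀ c ∈ E, ClauseSound T c)
    (hE : ∀ A ∈ T, RuleClosure (rules L E) (judg 6 A.code)) (x : ℕ) :
    RuleClosure (rules L E) (judg 9 x) ↔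
      ∃ A : Formula L, x = A.code ∧ A.IsPrenex ∧ GenDerivable T A := by
  constructor
  · exact fun h => (holds_judg T _ _ _ _ _).1 (h.holds hsound)
  · rintro ⟨A, rfl, hA, hder⟩
    exact ruleClosure_prenex 8 [A.code] (h := ⟨hA.ruleClosure, hder.ruleClosure hE⟩)

/-! ### The clause for the characteristic axioms -/

theorem eval_bigOr {ρ : List ℕ} {l : List Pat} {l' : List (Formula L)}
    (h : List.Forall₂ (fun p A => p.eval ρ = A.code) l l') :
    (Pat.bigOr l).eval ρ = (bigOr l').code := by
  induction h with
  | nil => rfl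
  | @cons p A l l' hp hl ih =>
    cases hl with
    | nil => exact hp
    | cons hq hl =>
      simp only [Pat.bigOr, Pat.or, Pat.eval] at ih ⊢
      rw [ih, hp]
      rfl

theorem eval_charFormula {m : ℕ} {ρ : List ℕ} {A : ℕ → Formula L}
    (h : ∀ i < m + 1, ρ.getD i 0 = (A i).code) :
    (Pat.charFormula m).eval ρ = (charFormula m A).code := by
  refine eval_bigOr ?_
  rw [List.forall₂_map_left_iff, List.forall₂_map_right_iff, List.forall₂_same]
  intro i hi
  refine eval_bigOr ?_
  rw [List.forall₂_map_left_iff, List.forall₂_map_right_iff, List.forall₂_same]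
  intro j hj
  rw [List.mem_range] at hi
  rw [List.mem_range'_1] at hj
  simp only [Pat.and, Pat.imp, Pat.eval, h i (by omega), h j (by omega)]
  rfl

theorem charClause_sound (m : ℕ) :
    ∀ c ∈ [Pat.axiomClause (m + 1) (Pat.charFormula m)], ClauseSound (charAxioms L m) c := by
  simp only [List.mem_singleton, forall_eq]
  exact axiomClause_sound fun ρ A hA => ⟨_, eval_charFormula hA, .ax ⟨A, rfl⟩⟩

theorem ruleClosure_charAxioms (m : ℕ) : ∀ A ∈ charAxioms L m,
    RuleClosure (rules L [Pat.axiomClause (m + 1) (Pat.charFormula m)]) (judg 6 A.code) := by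
  rintro _ ⟨A, rfl⟩
  have h := ruleClosure_axiomClause (E := [Pat.axiomClause (m + 1) (Pat.charFormula m)])
    (p := Pat.charFormula m) ((List.range (m + 1)).map A) (by simp [Pat.program])
  rwa [eval_charFormula (A := A)] at h
  intro i hi
  simp [List.getD_eq_getElem?_getD, List.getElem?_append, hi]

end Coding

/-! ### Enumeration of the valid prenex formulas -/

section Enumeration

variable [Primcodable (Σ n, L.Functions n)]
  [Primcodable (Σ n, L.Relations n)]

theorem rulesEnumerable_rules (hF : Computable fun f : Σ n, L.Functions n => f.1)
    (hR : Computable fun R : Σ n, L.Relations n => R.1) (E : List Clause) :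
    RulesEnumerable (rules L E) := by
  have key : ∀ k, Computable₂ fun a b => judg k a b := fun k =>
    (Primrec₂.natPair.comp (Primrec.const k) (Primrec₂.natPair.comp Primrec.fst
      (Primrec₂.natPair.comp Primrec.snd (Primrec.const _)))).to_comp
  refine (RulesEnumerable.union ?_ ?_).union (rulesEnumerable_clauseRules _)
  · exact rulesEnumerable_facts ((key 0).comp Computable.encode hF)
  · exact rulesEnumerable_facts ((key 1).comp Computable.encode hR)

theorem rePred_code_of_iff (hF : Computable fun f : Σ n, L.Functions n => f.1)
    (hR : Computable fun R : Σ n, L.Relations n => R.1) {T : Set (Formula L)} {E : List Clause}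
    (hsound : ∀ c ∈ E, ClauseSound T c)
    (hE : ∀ A ∈ T, RuleClosure (rules L E) (judg 6 A.code)) {p : Formula L → Prop}
    (hp : ∀ A : Formula L, A.IsPrenex → (p A ↔ GenDerivable T A)) :
    REPred fun c : ℕ => ∃ φ : Formula L, φ.IsPrenex ∧ p φ ∧ φ.code = c := by
  have hj : Computable fun c : ℕ => judg 9 c :=
    (Primrec₂.natPair.comp (Primrec.const 9)
      (Primrec₂.natPair.comp Primrec.id (Primrec.const _))).to_comp
  have hre : REPred fun c : ℕ => RuleClosure (rules L E) (judg 9 c) :=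
    Partrec.comp (rePred_ruleClosure (rulesEnumerable_rules hF hR E)) hj
  refine hre.of_eq fun c => ?_
  rw [ruleClosure_iff hsound hE]
  constructor
  · rintro ⟨A, hc, hA, hder⟩
    exact ⟨A, hA, (hp A hA).2 hder, hc.symm⟩
  · rintro ⟨A, hA, hval, hc⟩
    exact ⟨A, hc.symm, hA, (hp A hA).1 hval⟩

end Enumeration

end GoedelLogic

theorem theorem5p9 (L : FirstOrder.Language.{u, v}) (V : Set ℝ)
    (hV : GoedelLogic.IsTruthValueSet V) :
    -- `V` has exactly `m` elements
    (∀ m : ℕ, V.Finite → V.ncard = m → ∀ φ : GoedelLogic.Formula L, φ.IsPrenex →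
      (GoedelLogic.Valid.{u, v, w} V φ ↔
        GoedelLogic.Derivable (GoedelLogic.charAxioms L m) φ)) ∧
    -- `V` is uncountable
    (¬ V.Countable → ∀ φ : GoedelLogic.Formula L, φ.IsPrenex →
      (GoedelLogic.Valid.{u, v, w} V φ ↔ GoedelLogic.Derivable ∅ φ)) ∧
    -- axiomatizability: if `L` is effectively given, the valid prenex formulas are r.e.
    (V.Finite ∨ ¬ V.Countable →
      ∀ [Primcodable (Σ n, L.Functions n)] [Primcodable (Σ n, L.Relations n)],
        Computable (fun f : Σ n, L.Functions n => f.1) →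
        Computable (fun R : Σ n, L.Relations n => R.1) →
        REPred (fun c : ℕ => ∃ φ : GoedelLogic.Formula L,
          φ.IsPrenex ∧ GoedelLogic.Valid.{u, v, w} V φ ∧ φ.code = c)) := by
  open GoedelLogic in
  have hsub : SubstClosed (∅ : Set (Formula L)) := fun _ hA => hA.elim
  refine ⟨?_, fun hunc φ hφ => ?_, ?_⟩
  · rintro m hfin rfl φ hφ
    exact ⟨(derivable_of_valid hV hφ · |>.1 hfin), fun h =>
      (h.genDerivable (substClosed_charAxioms _)).valid hV (valid_of_mem_charAxioms hV hfin rfl)⟩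
  · exact ⟨(derivable_of_valid hV hφ · |>.2 hunc), fun h =>
      (h.genDerivable hsub).valid hV fun _ hA => hA.elim⟩
  · rintro (hfin | hunc) _ _ hF hR
    · exact rePred_code_of_iff hF hR (charClause_sound V.ncard) (ruleClosure_charAxioms _)
        fun φ hφ => ⟨fun h => ((derivable_of_valid hV hφ h).1 hfin).genDerivable
          (substClosed_charAxioms _), fun h => h.valid hV (valid_of_mem_charAxioms hV hfin rfl)⟩
    · exact rePred_code_of_iff (T := ∅) (E := []) hF hR (by simp) (fun _ hA => hA.elim)
        fun φ hφ => ⟨fun h => ((derivable_of_valid hV hφ h).2 hunc).genDerivable hsub,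
          fun h => h.valid hV fun _ hA => hA.elim⟩
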